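/- Let $\Omega\subset\mathbb C^n$ be a domain, let $\mathcal F$ be a family of holomorphic functions on $\Omega$, and let $z_0\in\Omega$. The family $\mathcal F$ is called normal in an open set $U\subset\Omega$ if every sequence in $\mathcal F$ has either a subsequence converging to a finite limit function uniformly on each compact subset of $U$, or a subsequence converging to $\infty$ uniformly on each compact subset of $U$. It is called normal at $z_0$ if it is normal in some open neighborhood $U\subset\Omega$ of $z_0$. For a holomorphic function $f$ put $$f^\sharp(z)=\sup_{|v|=1}\sqrt{L_z(\log(1+|f|^2),v)},\qquad L_z(\varphi,v)=\sum_{k,l=1}^n\frac{\partial^2\varphi}{\partial z_k\,\partial\overline z_l}(z)\,v_k\overline{v}_l,$$ where $|\cdot|$ is the Euclidean norm on $\mathbb C^n$. Then $\mathcal F$ is not normal at $z_0$ if and only if for every $\alpha\in(-1,\infty)$ there exist sequences $f_j\in\mathcal F$, $z_j\in\Omega$ with $z_j\to z_0$, and $r_j>0$ with $r_j\to0$, such that the sequence $$g_j(z)=r_j^{\alpha}f_j(z_j+r_jz)$$ converges locally uniformly on $\mathbb C^n$ to a non-constant entire function $g$ satisfying $g^\sharp(z)\le g^\sharp(0)=1$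 for all $z\in\mathbb C^n$. (For every compact $K\subset\mathbb C^n$, the function $g_j$ is defined on $K$ for all sufficiently large $j$.) -/

import Mathlib

open Filter Topology

noncomputable section

/-- The Wirtinger derivative `∂u/∂z_k = (∂u/∂x_k - i ∂u/∂y_k) / 2` at `z`, for a complex-valued
function `u` of `z = x + i y ∈ ℂⁿ`. -/
def dz {n : ℕ} (k : Fin n) (u : EuclideanSpace ℂ (Fin n) → ℂ) (z : EuclideanSpace ℂ (Fin n)) : ℂ :=
  (1 / 2) * (lineDeriv ℝ u z (EuclideanSpace.single k 1)
    - Complex.I * lineDeriv ℝ u z (EuclideanSpace.single k Complex.I))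

/-- The Wirtinger derivative `∂u/∂z̄_k = (∂u/∂x_k + i ∂u/∂y_k) / 2` at `z`. -/
def dzbar {n : ℕ} (k : Fin n) (u : EuclideanSpace ℂ (Fin n) → ℂ) (z : EuclideanSpace ℂ (Fin n)) :
    ℂ :=
  (1 / 2) * (lineDeriv ℝ u z (EuclideanSpace.single k 1)
    + Complex.I * lineDeriv ℝ u z (EuclideanSpace.single k Complex.I))

/-- The Levi form `L_z(φ, v) = ∑_{k,l} (∂²φ/∂z_k ∂z̄_l)(z) v_k v̄_l` of a real-valued `φ`.
For `φ` of class `C²` the form is hermitian, so the sum is real and taking the real part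
only changes its type. -/
def leviForm {n : ℕ} (φ : EuclideanSpace ℂ (Fin n) → ℝ) (z v : EuclideanSpace ℂ (Fin n)) : ℝ :=
  (∑ k, ∑ l, dz k (dzbar l (fun w => (φ w : ℂ))) z * v k * (starRingEnd ℂ) (v l)).re

/-- The spherical derivative `f♯(z) = sup_{|v| = 1} √(L_z(log(1 + |f|²), v))`. -/
def sphericalDeriv {n : ℕ} (f : EuclideanSpace ℂ (Fin n) → ℂ) (z : EuclideanSpace ℂ (Fin n)) : ℝ :=
  ⨆ v : Metric.sphere (0 : EuclideanSpace ℂ (Fin n)) 1,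
    √(leviForm (fun w => Real.log (1 + ‖f w‖ ^ 2)) z v)

/-- `F` is normal in `U`: every sequence in `F` has a subsequence that converges to a
(finite) limit function uniformly on each compact subset of `U`, or a subsequence that
converges to `∞` uniformly on each compact subset of `U`. -/
def IsNormalIn {n : ℕ} (F : Set (EuclideanSpace ℂ (Fin n) → ℂ))
    (U : Set (EuclideanSpace ℂ (Fin n))) : Prop :=
  ∀ f : ℕ → EuclideanSpace ℂ (Fin n) → ℂ, (∀ j, f j ∈ F) →
    ∃ s : ℕ → ℕ, StrictMono s ∧
      ((∃ g : EuclideanSpace ℂ (Fin n) → ℂ, ∀ K ⊆ U, IsCompact K →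
          TendstoUniformlyOn (fun j => f (s j)) g atTop K) ∨
        (∀ K ⊆ U, IsCompact K → ∀ M : ℝ, ∀ᶠ j in atTop, ∀ z ∈ K, M < ‖f (s j) z‖))

/-- A family `F` of functions on `Ω` is normal at `z₀` if it is normal in some open neighborhood of
`z₀` contained in `Ω`. -/
def IsNormalAt {n : ℕ} (F : Set (EuclideanSpace ℂ (Fin n) → ℂ))
    (Ω : Set (EuclideanSpace ℂ (Fin n))) (z₀ : EuclideanSpace ℂ (Fin n)) : Prop :=
  ∃ U ⊆ Ω, IsOpen U ∧ z₀ ∈ U ∧ IsNormalIn F U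

end

/-! Suppose the family is not normal at `z₀`. For a centre `z` in a small ball of radius `ρ` about
`z₀`, take the scale `r = t (ρ - |z - z₀|)` and let `Ψ(z, t)` be the spherical derivative at `0` of
`w ↦ r^α f(z + r w)`. If `Ψ < 1` held on the ball for every `f` at some fixed `t > 0`, the spherical
derivatives would be uniformly bounded on the half ball, and Marty's theorem would give normality.
So `Ψ ≥ 1` somewhere. Since `α > -1`, `Ψ` is continuous and vanishes at `r = 0`; the least `t` with
`Ψ(z, t) ≥ 1` for some `z` is therefore positive, with `Ψ(z, t) = 1` and `Ψ(·, t) ≤ 1` on the ball.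

Rescale at this `z` and `r`. At `z + r w` the natural scale differs from `r` only by a factor
between `1 - t|w|` and `1 + t|w|`, so the rescaled functions have spherical derivative `1` at `0`
and, on bounded sets, at most a quantity tending to `1` as `t → 0`. Marty's theorem on the whole
space gives a convergent subsequence; the limit `∞` is incompatible with the value `1` at `0`, and
the bounds pass to the entire limit.

For the converse `α = 0` suffices: the points `z_j + r_j w` collapse to `z₀`, so normality makes the
limit constant.

Marty's theorem comes from an Ascoli argument in a model of the Riemann sphere, with Hurwitz's
theorem separating finite from infinite limits. -/

/-! ### Cauchy estimates and limits of holomorphic functions on normed spaces. -/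

section Cauchy

variable {E : Type*} [NormedAddCommGroup E] [NormedSpace ℂ E]

theorem hasDerivAt_comp_line {f : E → ℂ} {a v : E} {ζ : ℂ}
    (hf : DifferentiableAt ℂ f (a + ζ • v)) :
    HasDerivAt (fun ζ : ℂ => f (a + ζ • v)) (fderiv ℂ f (a + ζ • v) v) ζ := by
  have h : HasDerivAt (fun ζ : ℂ => a + ζ • v) v ζ := by
    simpa using ((hasDerivAt_id ζ).smul_const v).const_add a
  exact hf.hasFDerivAt.comp_hasDerivAt ζ h

theorem norm_fderiv_le_of_norm_le_ball {f : E → ℂ} {a : E} {R C : ℝ} (hR : 0 < R)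
    (hd : DifferentiableOn ℂ f (Metric.ball a R)) (hC : ∀ x ∈ Metric.ball a R, ‖f x‖ ≤ C) :
    ‖fderiv ℂ f a‖ ≤ 2 * C / R := by
  have hC0 : 0 ≤ C := (norm_nonneg _).trans (hC a (Metric.mem_ball_self hR))
  refine ContinuousLinearMap.opNorm_le_bound _ (by positivity) fun v => ?_
  rcases eq_or_ne v 0 with rfl | hv
  · simp
  have hv' : 0 < ‖v‖ := norm_pos_iff.2 hv
  -- With this radius the disc `a + ζ v` stays within distance `R / 2` of `a`; this is the origin of
  -- the factor `2`.
  set s : ℝ := R / (2 * ‖v‖) with hs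
  have hs0 : 0 < s := by positivity
  have hmem : ∀ ζ ∈ Metric.closedBall (0 : ℂ) s, a + ζ • v ∈ Metric.ball a R := by
    intro ζ hζ
    rw [mem_closedBall_zero_iff] at hζ
    rw [mem_ball_iff_norm, add_sub_cancel_left, norm_smul]
    calc ‖ζ‖ * ‖v‖ ≤ s * ‖v‖ := by gcongr
      _ = R / 2 := by rw [hs]; field_simp
      _ < R := by linarith
  have hder : ∀ ζ ∈ Metric.closedBall (0 : ℂ) s,
      HasDerivAt (fun ζ : ℂ => f (a + ζ • v)) (fderiv ℂ f (a + ζ • v) v) ζ := fun ζ hζ =>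
    hasDerivAt_comp_line ((hd _ (hmem ζ hζ)).differentiableAt (Metric.isOpen_ball.mem_nhds (hmem ζ hζ)))
  have hdc : DiffContOnCl ℂ (fun ζ : ℂ => f (a + ζ • v)) (Metric.ball 0 s) := by
    apply DifferentiableOn.diffContOnCl_ball (U := Metric.closedBall 0 s)
    · exact fun ζ hζ => (hder ζ hζ).differentiableAt.differentiableWithinAt
    · exact subset_rfl
  have h := Complex.norm_deriv_le_of_forall_mem_sphere_norm_le hs0 hdc
    (fun ζ hζ => hC _ (hmem ζ (Metric.sphere_subset_closedBall hζ)))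
  have h0 := (hder 0 (Metric.mem_closedBall_self hs0.le)).deriv
  rw [h0] at h
  simp only [zero_smul, add_zero] at h
  refine h.trans (le_of_eq ?_)
  rw [hs]; field_simp

theorem norm_fderiv_sub_le_of_norm_sub_le_ball {f g : E → ℂ} {a : E} {R C : ℝ} (hR : 0 < R)
    (hf : DifferentiableOn ℂ f (Metric.ball a R)) (hg : DifferentiableOn ℂ g (Metric.ball a R))
    (hC : ∀ x ∈ Metric.ball a R, ‖f x - g x‖ ≤ C) :
    ‖fderiv ℂ f a - fderiv ℂ g a‖ ≤ 2 * C / R := by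
  have hn := Metric.ball_mem_nhds a hR
  rw [← fderiv_sub (hf.differentiableAt hn) (hg.differentiableAt hn)]
  exact norm_fderiv_le_of_norm_le_ball hR (hf.sub hg) hC

/-- A uniform limit of holomorphic functions on a ball is complex differentiable at its centre,
and the derivatives converge there. -/
theorem differentiableAt_and_tendsto_fderiv_of_tendstoUniformlyOn_ball {f : ℕ → E → ℂ}
    {g : E → ℂ} {a : E} {R : ℝ} (hR : 0 < R)
    (hd : ∀ᶠ j in atTop, DifferentiableOn ℂ (f j) (Metric.ball a R))
    (hfg : TendstoUniformlyOn f g atTop (Metric.ball a R)) :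
    DifferentiableAt ℂ g a ∧ Tendsto (fun j => fderiv ℂ (f j) a) atTop (𝓝 (fderiv ℂ g a)) := by
  have hsub : ∀ x ∈ Metric.ball a (R / 2), Metric.ball x (R / 2) ⊆ Metric.ball a R := by
    intro x hx
    apply Metric.ball_subset_ball'
    rw [Metric.mem_ball] at hx
    linarith
  have hcau : UniformCauchySeqOn (fun j => fderiv ℂ (f j)) atTop (Metric.ball a (R / 2)) := by
    rw [Metric.uniformCauchySeqOn_iff]
    intro ε hε
    obtain ⟨N, hN⟩ := Metric.uniformCauchySeqOn_iff.1 hfg.uniformCauchySeqOn (ε * R / 8)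
      (by positivity)
    obtain ⟨N', hN'⟩ := eventually_atTop.1 hd
    refine ⟨max N N', fun m hm k hk x hx => ?_⟩
    rw [dist_eq_norm]
    have := norm_fderiv_sub_le_of_norm_sub_le_ball (a := x) (half_pos hR)
      ((hN' m (le_of_max_le_right hm)).mono (hsub x hx))
      ((hN' k (le_of_max_le_right hk)).mono (hsub x hx)) (C := ε * R / 8) (fun y hy => by
        rw [← dist_eq_norm]
        exact (hN m (le_of_max_le_left hm) k (le_of_max_le_left hk) y (hsub x hx hy)).le)
    have h2 : 2 * (ε * R / 8) / (R / 2) = ε / 2 := by field_simp; ring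
    rw [h2] at this
    linarith
  have hlim : ∀ x, ∃ L : E →L[ℂ] ℂ, x ∈ Metric.ball a (R / 2) →
      Tendsto (fun j => fderiv ℂ (f j) x) atTop (𝓝 L) := by
    intro x
    by_cases hx : x ∈ Metric.ball a (R / 2)
    · obtain ⟨L, hL⟩ := cauchySeq_tendsto_of_complete (hcau.cauchy_map hx)
      exact ⟨L, fun _ => hL⟩
    · exact ⟨0, fun h => absurd h hx⟩
  choose g' hg' using hlim
  have hunif : TendstoUniformlyOn (fun j => fderiv ℂ (f j)) g' atTop (Metric.ball a (R / 2)) :=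
    hcau.tendstoUniformlyOn_of_tendsto hg'
  have hnhd : Metric.ball a (R / 2) ∈ 𝓝 a := Metric.ball_mem_nhds a (half_pos hR)
  have hmain : HasFDerivAt g (g' a) a := by
    refine hasFDerivAt_of_tendstoUniformlyOnFilter (l := atTop) (f := f)
      (f' := fun j => fderiv ℂ (f j)) ?_ ?_ ?_
    · exact (tendstoUniformlyOn_iff_tendstoUniformlyOnFilter.1 hunif).mono_right
        (le_principal_iff.2 hnhd)
    · filter_upwards [hd.prod_mk hnhd] with p hp
      exact (hp.1.differentiableAt (mem_of_superset
        (Metric.ball_mem_nhds p.2 (half_pos hR)) (hsub _ hp.2))).hasFDerivAt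
    · filter_upwards [hnhd] with y hy
      exact hfg.tendsto_at (Metric.ball_subset_ball (by linarith) hy)
  refine ⟨hmain.differentiableAt, ?_⟩
  rw [hmain.fderiv]
  exact hg' a (Metric.mem_ball_self (half_pos hR))

variable [ProperSpace E]

/-- The Cauchy estimate is applied to the difference of `f` and its translate by `x - a`, which is
small by uniform continuity. -/
theorem continuousOn_fderiv_of_differentiableOn {f : E → ℂ} {U : Set E} (hU : IsOpen U)
    (hf : DifferentiableOn ℂ f U) : ContinuousOn (fderiv ℂ f) U := by
  intro a ha
  apply ContinuousAt.continuousWithinAt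
  obtain ⟨R, hR, hRU⟩ := Metric.nhds_basis_closedBall.mem_iff.1 (hU.mem_nhds ha)
  have huc := (isCompact_closedBall a R).uniformContinuousOn_of_continuous
    (hf.continuousOn.mono hRU)
  rw [Metric.uniformContinuousOn_iff] at huc
  rw [Metric.continuousAt_iff]
  intro ε hε
  obtain ⟨δ, hδ, h⟩ := huc (ε * R / 8) (by positivity)
  refine ⟨min δ (R / 2), by positivity, fun x hx => ?_⟩
  have hxδ := hx.trans_le (min_le_left _ _)
  have hxR := hx.trans_le (min_le_right _ _)
  have hm1 : ∀ y ∈ Metric.ball a (R / 2), y ∈ Metric.closedBall a R := fun y hy =>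
    Metric.ball_subset_closedBall (Metric.ball_subset_ball (by linarith) hy)
  have hm2 : ∀ y ∈ Metric.ball a (R / 2), y + (x - a) ∈ Metric.closedBall a R := by
    intro y hy
    rw [mem_ball_iff_norm] at hy
    rw [dist_eq_norm] at hxR
    rw [mem_closedBall_iff_norm]
    calc ‖y + (x - a) - a‖ = ‖(y - a) + (x - a)‖ := by congr 1; abel
      _ ≤ ‖y - a‖ + ‖x - a‖ := norm_add_le _ _
      _ ≤ R := by linarith
  have hd2 : DifferentiableOn ℂ (fun y => f (y + (x - a))) (Metric.ball a (R / 2)) := by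
    refine hf.comp (by fun_prop) fun y hy => hRU (hm2 y hy)
  have key := norm_fderiv_sub_le_of_norm_sub_le_ball (half_pos hR) hd2
    (hf.mono fun y hy => hRU (hm1 y hy)) (C := ε * R / 8) fun y hy => by
      rw [← dist_eq_norm]
      refine (h _ (hm2 y hy) _ (hm1 y hy) ?_).le
      simpa [dist_eq_norm] using hxδ
  rw [fderiv_comp_add_right, add_sub_cancel] at key
  rw [dist_eq_norm]
  have h2 : 2 * (ε * R / 8) / (R / 2) = ε / 2 := by field_simp; ring
  rw [h2] at key
  linarith

/-- Difference quotients with step `1 / (m + 1)` are holomorphic and converge locally uniformly to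
the directional derivative. This supplies the second derivatives needed for the Levi form. -/
theorem differentiable_fderiv_apply {g : E → ℂ} (hg : Differentiable ℂ g) (w : E) :
    Differentiable ℂ fun x => fderiv ℂ g x w := by
  have hcont : Continuous (fderiv ℂ g) := by
    rw [← continuousOn_univ]
    exact continuousOn_fderiv_of_differentiableOn isOpen_univ hg.differentiableOn
  intro a
  refine (differentiableAt_and_tendsto_fderiv_of_tendstoUniformlyOn_ball (R := 1)
    (f := fun m x => ((m : ℂ) + 1) * (g (x + ((m : ℂ) + 1)⁻¹ • w) - g x)) one_pos
    (Eventually.of_forall fun m => ?_) ?_).1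
  · apply Differentiable.differentiableOn
    refine (Differentiable.sub (hg.comp (by fun_prop)) hg).const_mul _
  rw [Metric.tendstoUniformlyOn_iff]
  intro ε hε
  have huc := (isCompact_closedBall a (1 + ‖w‖)).uniformContinuousOn_of_continuous
    hcont.continuousOn
  rw [Metric.uniformContinuousOn_iff] at huc
  obtain ⟨δ, hδ, h⟩ := huc (ε / (2 * (‖w‖ + 1))) (by positivity)
  have hlim : Tendsto (fun m : ℕ => (1 / ((m : ℝ) + 1)) * ‖w‖) atTop (𝓝 (0 * ‖w‖)) :=
    tendsto_one_div_add_atTop_nhds_zero_nat.mul_const _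
  rw [zero_mul] at hlim
  filter_upwards [hlim.eventually_lt_const hδ] with m hm x hx
  set c : ℂ := (m : ℂ) + 1 with hc
  have hcn : ‖c‖ = (m : ℝ) + 1 := by
    rw [hc]; norm_cast
  have hc1 : 1 ≤ ‖c‖ := by rw [hcn]; linarith [Nat.cast_nonneg (α := ℝ) m]
  have hc0 : c ≠ 0 := norm_pos_iff.1 (by linarith)
  have hnw : ‖c⁻¹ • w‖ = (1 / ((m : ℝ) + 1)) * ‖w‖ := by rw [norm_smul, norm_inv, hcn, one_div]
  rw [mem_ball_iff_norm] at hx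
  have hxm : x ∈ Metric.closedBall a (1 + ‖w‖) := by
    rw [mem_closedBall_iff_norm]; linarith [norm_nonneg w]
  have hseg : ∀ y ∈ segment ℝ x (x + c⁻¹ • w), ‖y - x‖ ≤ ‖c⁻¹ • w‖ := by
    intro y hy
    simpa using norm_sub_le_of_mem_segment hy
  have hlew : ‖c⁻¹ • w‖ ≤ ‖w‖ := by
    rw [norm_smul, norm_inv]
    exact mul_le_of_le_one_left (norm_nonneg _) (inv_le_one_of_one_le₀ hc1)
  -- Mean value inequality for `g` minus its derivative at `x`, along the segment of the difference
  -- quotient.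
  have hmv := (convex_segment x (x + c⁻¹ • w)).norm_image_sub_le_of_norm_hasFDerivWithin_le
    (f := fun y => g y - fderiv ℂ g x y) (f' := fun y => fderiv ℂ g y - fderiv ℂ g x)
    (C := ε / (2 * (‖w‖ + 1))) (𝕜 := ℂ)
    (fun y _ => ((hg y).hasFDerivAt.sub (fderiv ℂ g x).hasFDerivAt).hasFDerivWithinAt)
    (fun y hy => by
      rw [← dist_eq_norm]
      refine (h y ?_ x hxm ?_).le
      · rw [mem_closedBall_iff_norm]
        calc ‖y - a‖ = ‖(y - x) + (x - a)‖ := by congr 1; abel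
          _ ≤ ‖y - x‖ + ‖x - a‖ := norm_add_le _ _
          _ ≤ 1 + ‖w‖ := by linarith [hseg y hy]
      · rw [dist_eq_norm]; rw [hnw] at hseg; exact (hseg y hy).trans_lt hm)
    (left_mem_segment ℝ _ _) (right_mem_segment ℝ _ _)
  have e1 : (g (x + c⁻¹ • w) - fderiv ℂ g x (x + c⁻¹ • w)) - (g x - fderiv ℂ g x x)
      = c⁻¹ * (c * (g (x + c⁻¹ • w) - g x) - fderiv ℂ g x w) := by
    rw [map_add, map_smul, smul_eq_mul]; field_simp; ring
  rw [add_sub_cancel_left, e1, norm_mul, norm_smul, ← mul_assoc, mul_comm _ ‖c⁻¹‖, mul_assoc] at hmv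
  have hci : 0 < ‖c⁻¹‖ := by rw [norm_inv]; positivity
  have h3 := le_of_mul_le_mul_left hmv hci
  rw [dist_comm, dist_eq_norm]
  refine h3.trans_lt ?_
  rw [div_mul_eq_mul_div, div_lt_iff₀ (by positivity)]
  nlinarith [norm_nonneg w]

end Cauchy

/-! ### The Levi form of `log(1 + |g|²)` and the spherical derivative. -/

section Levi

variable {n : ℕ}

theorem one_add_norm_sq_eq_mul_conj (w : ℂ) :
    ((1 + ‖w‖ ^ 2 : ℝ) : ℂ) = 1 + w * (starRingEnd ℂ) w := by
  rw [Complex.mul_conj']; push_cast; rfl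

theorem one_add_mul_conj_ne_zero (w : ℂ) : 1 + w * (starRingEnd ℂ) w ≠ 0 := by
  rw [← one_add_norm_sq_eq_mul_conj]
  exact Complex.ofReal_ne_zero.2 (by positivity)

theorem hasDerivAt_comp_real_line {E : Type*} [NormedAddCommGroup E] [NormedSpace ℂ E]
    {f : E → ℂ} (a v : E) (hf : DifferentiableAt ℂ f a) :
    HasDerivAt (fun t : ℝ => f (a + t • v)) (fderiv ℂ f a v) 0 := by
  have h := (hasDerivAt_comp_line (f := f) (a := a) (v := v) (ζ := ((0 : ℝ) : ℂ))
    (by simpa using hf)).comp_ofReal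
  simpa using h

theorem hasDerivAt_one_add_mul_conj {p : ℝ → ℂ} {p' : ℂ} {t : ℝ} (hp : HasDerivAt p p' t) :
    HasDerivAt (fun t => 1 + p t * (starRingEnd ℂ) (p t))
      (p' * (starRingEnd ℂ) (p t) + p t * (starRingEnd ℂ) p') t :=
  (hp.mul hp.star).const_add 1

theorem lineDeriv_log_one_add_norm_sq {g : EuclideanSpace ℂ (Fin n) → ℂ} (hg : Differentiable ℂ g)
    (w v : EuclideanSpace ℂ (Fin n)) :
    lineDeriv ℝ (fun w => ((Real.log (1 + ‖g w‖ ^ 2) : ℝ) : ℂ)) w v =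
      (fderiv ℂ g w v * (starRingEnd ℂ) (g w) + g w * (starRingEnd ℂ) (fderiv ℂ g w v)) /
        (1 + g w * (starRingEnd ℂ) (g w)) := by
  have h1 := hasDerivAt_comp_real_line w v (hg w)
  have h2 := hasDerivAt_one_add_mul_conj h1
  have hre : HasDerivAt (fun t : ℝ => 1 + ‖g (w + t • v)‖ ^ 2)
      (fderiv ℂ g w v * (starRingEnd ℂ) (g w) + g w * (starRingEnd ℂ) (fderiv ℂ g w v)).re 0 := by
    have h3 := Complex.reCLM.hasFDerivAt.comp_hasDerivAt (0 : ℝ) h2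
    simp only [Complex.reCLM_apply, zero_smul, add_zero] at h3
    refine h3.congr_of_eventuallyEq (Eventually.of_forall fun t => ?_)
    simp only [Function.comp, Complex.reCLM_apply]
    rw [← one_add_norm_sq_eq_mul_conj, Complex.ofReal_re]
  have hlog := (hre.log (by positivity)).ofReal_comp
  have him : (((fderiv ℂ g w v * (starRingEnd ℂ) (g w) +
      g w * (starRingEnd ℂ) (fderiv ℂ g w v)).re : ℝ) : ℂ) =
      fderiv ℂ g w v * (starRingEnd ℂ) (g w) + g w * (starRingEnd ℂ) (fderiv ℂ g w v) := by
    apply Complex.conj_eq_iff_re.1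
    simp only [map_add, map_mul, Complex.conj_conj]; ring
  have : HasLineDerivAt ℝ (fun w => ((Real.log (1 + ‖g w‖ ^ 2) : ℝ) : ℂ)) _ w v := hlog
  rw [this.lineDeriv, Complex.ofReal_div, him]
  simp only [zero_smul, add_zero]
  rw [one_add_norm_sq_eq_mul_conj]

theorem single_I (k : Fin n) :
    EuclideanSpace.single k Complex.I = Complex.I • EuclideanSpace.single k (1 : ℂ) := by
  ext i; simp

theorem dzbar_log_one_add_norm_sq {g : EuclideanSpace ℂ (Fin n) → ℂ} (hg : Differentiable ℂ g)
    (l : Fin n) (w : EuclideanSpace ℂ (Fin n)) :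
    dzbar l (fun w => ((Real.log (1 + ‖g w‖ ^ 2) : ℝ) : ℂ)) w =
      g w * (starRingEnd ℂ) (fderiv ℂ g w (EuclideanSpace.single l 1)) /
        (1 + g w * (starRingEnd ℂ) (g w)) := by
  rw [dzbar, lineDeriv_log_one_add_norm_sq hg, lineDeriv_log_one_add_norm_sq hg, single_I,
    map_smul, smul_eq_mul, map_mul, Complex.conj_I]
  have := one_add_mul_conj_ne_zero (g w)
  field_simp
  ring_nf
  rw [Complex.I_sq]
  ring

/-- Second derivatives of `g` drop out because the conjugate of `∂g/∂z_l` is antiholomorphic. The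
remaining matrix has rank at most one, so the Levi form is a square. -/
theorem dz_dzbar_log_one_add_norm_sq {g : EuclideanSpace ℂ (Fin n) → ℂ}
    (hg : Differentiable ℂ g) (k l : Fin n) (w : EuclideanSpace ℂ (Fin n)) :
    dz k (dzbar l (fun w => ((Real.log (1 + ‖g w‖ ^ 2) : ℝ) : ℂ))) w =
      fderiv ℂ g w (EuclideanSpace.single k 1) *
        (starRingEnd ℂ) (fderiv ℂ g w (EuclideanSpace.single l 1)) /
        (1 + g w * (starRingEnd ℂ) (g w)) ^ 2 := by
  have hG := differentiable_fderiv_apply hg (EuclideanSpace.single l (1 : ℂ))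
  set G := fun x => fderiv ℂ g x (EuclideanSpace.single l (1 : ℂ)) with hGdef
  have hline : ∀ v, lineDeriv ℝ (fun w => g w * (starRingEnd ℂ) (G w) /
      (1 + g w * (starRingEnd ℂ) (g w))) w v =
      ((fderiv ℂ g w v * (starRingEnd ℂ) (G w) + g w * (starRingEnd ℂ) (fderiv ℂ G w v)) *
        (1 + g w * (starRingEnd ℂ) (g w)) - g w * (starRingEnd ℂ) (G w) *
        (fderiv ℂ g w v * (starRingEnd ℂ) (g w) + g w * (starRingEnd ℂ) (fderiv ℂ g w v))) /
        (1 + g w * (starRingEnd ℂ) (g w)) ^ 2 := by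
    intro v
    have h1 := hasDerivAt_comp_real_line w v (hg w)
    have h2 := hasDerivAt_comp_real_line w v (hG w)
    have h3 := (h1.mul h2.star).div (hasDerivAt_one_add_mul_conj h1) (one_add_mul_conj_ne_zero _)
    have : HasLineDerivAt ℝ (fun w => g w * (starRingEnd ℂ) (G w) /
      (1 + g w * (starRingEnd ℂ) (g w))) _ w v := h3
    rw [this.lineDeriv]
    simp [zero_smul, add_zero]
  have hfun : dzbar l (fun w => ((Real.log (1 + ‖g w‖ ^ 2) : ℝ) : ℂ)) =
      fun w => g w * (starRingEnd ℂ) (G w) / (1 + g w * (starRingEnd ℂ) (g w)) :=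
    funext fun w => dzbar_log_one_add_norm_sq hg l w
  rw [hfun, dz, hline, hline, single_I]
  simp only [map_smul, smul_eq_mul, map_mul, Complex.conj_I]
  have := one_add_mul_conj_ne_zero (g w)
  field_simp
  ring_nf
  simp only [Complex.I_sq]
  ring

theorem leviForm_log_one_add_norm_sq {g : EuclideanSpace ℂ (Fin n) → ℂ}
    (hg : Differentiable ℂ g) (z v : EuclideanSpace ℂ (Fin n)) :
    leviForm (fun w => Real.log (1 + ‖g w‖ ^ 2)) z v =
      (‖fderiv ℂ g z v‖ / (1 + ‖g z‖ ^ 2)) ^ 2 := by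
  have hv : fderiv ℂ g z v = ∑ k, v k * fderiv ℂ g z (EuclideanSpace.single k 1) := by
    conv_lhs => rw [← (EuclideanSpace.basisFun (Fin n) ℂ).sum_repr v]
    simp [map_sum]
  have hsum : (∑ k, ∑ l, dz k (dzbar l (fun w => ((Real.log (1 + ‖g w‖ ^ 2) : ℝ) : ℂ))) z * v k *
      (starRingEnd ℂ) (v l)) =
      ((((‖fderiv ℂ g z v‖ / (1 + ‖g z‖ ^ 2)) ^ 2 : ℝ)) : ℂ) := by
    rw [div_pow, Complex.ofReal_div, Complex.ofReal_pow, Complex.ofReal_pow,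
      one_add_norm_sq_eq_mul_conj, ← Complex.mul_conj', hv, map_sum, Finset.sum_mul_sum,
      Finset.sum_div]
    refine Finset.sum_congr rfl fun k _ => ?_
    rw [Finset.sum_div]
    refine Finset.sum_congr rfl fun l _ => ?_
    rw [dz_dzbar_log_one_add_norm_sq hg, map_mul]
    ring
  rw [leviForm, hsum, Complex.ofReal_re]

theorem sphericalDeriv_eq {g : EuclideanSpace ℂ (Fin n) → ℂ} (hg : Differentiable ℂ g)
    (z : EuclideanSpace ℂ (Fin n)) :
    sphericalDeriv g z = ‖fderiv ℂ g z‖ / (1 + ‖g z‖ ^ 2) := by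
  have h1 : ∀ v : Metric.sphere (0 : EuclideanSpace ℂ (Fin n)) 1,
      √(leviForm (fun w => Real.log (1 + ‖g w‖ ^ 2)) z v) =
        ‖fderiv ℂ g z v‖ * (1 + ‖g z‖ ^ 2)⁻¹ := by
    intro v
    rw [leviForm_log_one_add_norm_sq hg, Real.sqrt_sq (by positivity), div_eq_mul_inv]
  rw [sphericalDeriv]
  simp only [h1]
  rw [← Real.iSup_mul_of_nonneg (by positivity), ← ContinuousLinearMap.sSup_sphere_eq_norm,
    sSup_image', div_eq_mul_inv]

end Levi

/-! ### An Arzelà–Ascoli theorem. -/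

section Ascoli

/-- Locally equi-Lipschitz sequences with values in a compact set have locally uniformly convergent
subsequences. -/
theorem exists_subseq_tendstoLocallyUniformlyOn_of_locally_lipschitz {X Y : Type*}
    [PseudoMetricSpace X] [ProperSpace X] [MetricSpace Y] {S : Set Y}
    (hS : IsCompact S) {F : ℕ → X → Y} (hF : ∀ j x, F j x ∈ S) {U : Set X}
    (hL : ∀ a ∈ U, ∃ δ > 0, ∃ L : ℝ, ∀ᶠ j in atTop, ∀ x ∈ Metric.ball a δ,
      ∀ y ∈ Metric.ball a δ, dist (F j x) (F j y) ≤ L * dist x y) :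
    ∃ s : ℕ → ℕ, StrictMono s ∧ ∃ G : X → Y,
      TendstoLocallyUniformlyOn (fun j => F (s j)) G atTop U := by
  rcases isEmpty_or_nonempty X with hX | hX
  · refine ⟨id, strictMono_id, F 0, ?_⟩
    exact fun u _ x _ => isEmptyElim x
  -- Compactness of the countable product replaces the diagonal argument on a dense sequence.
  obtain ⟨y, -, s, hs, hlim⟩ := (isCompact_univ_pi fun _ : ℕ => hS).tendsto_subseq
    (x := fun j k => F j (TopologicalSpace.denseSeq X k)) (fun j k _ => hF j _)
  rw [tendsto_pi_nhds] at hlim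
  have hcau : ∀ a ∈ U, ∃ t ∈ 𝓝 a, UniformCauchySeqOn (fun j => F (s j)) atTop t := by
    intro a ha
    obtain ⟨δ, hδ, L, hj⟩ := hL a ha
    have hj' := hs.tendsto_atTop.eventually hj
    refine ⟨Metric.ball a (δ / 2), Metric.ball_mem_nhds a (half_pos hδ), ?_⟩
    rw [Metric.uniformCauchySeqOn_iff]
    intro ε hε
    -- The first bound keeps the nearby dense point in the ball where the Lipschitz estimate holds;
    -- the second makes each Lipschitz error at most `ε / 4`. With two errors `ε / 8` at the dense
    -- point, the total is below `ε`.
    set η := min (δ / 2) (ε / (4 * (|L| + 1))) with hη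
    have hη0 : 0 < η := by positivity
    obtain ⟨T, hT⟩ := (isCompact_closedBall a (δ / 2)).elim_finite_subcover
      (fun k => Metric.ball (TopologicalSpace.denseSeq X k) η) (fun _ => Metric.isOpen_ball)
      (fun x _ => by
        obtain ⟨k, hk⟩ := (TopologicalSpace.denseRange_denseSeq X).exists_dist_lt x hη0
        exact Set.mem_iUnion.2 ⟨k, hk⟩)
    have hN : ∀ᶠ j in atTop, ∀ k ∈ T, dist (F (s j) (TopologicalSpace.denseSeq X k)) (y k) < ε / 8 :=
      (Finset.eventually_all T).2 fun k _ =>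
        Metric.tendsto_nhds.1 (hlim k) (ε / 8) (by positivity)
    obtain ⟨N, hN⟩ := eventually_atTop.1 (hN.and hj')
    refine ⟨N, fun m hm l hl x hx => ?_⟩
    obtain ⟨k, hkT, hk⟩ := Set.mem_iUnion₂.1 (hT (Metric.ball_subset_closedBall hx))
    rw [Metric.mem_ball] at hk hx
    have hxa : x ∈ Metric.ball a δ := by rw [Metric.mem_ball]; linarith
    have hka : TopologicalSpace.denseSeq X k ∈ Metric.ball a δ := by
      rw [Metric.mem_ball]
      have := dist_triangle (TopologicalSpace.denseSeq X k) x a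
      rw [dist_comm _ x] at this
      linarith [min_le_left (δ / 2) (ε / (4 * (|L| + 1)))]
    have hLe : L * dist x (TopologicalSpace.denseSeq X k) ≤ ε / 4 := by
      calc L * dist x (TopologicalSpace.denseSeq X k)
          ≤ (|L| + 1) * (ε / (4 * (|L| + 1))) := by
            refine mul_le_mul ((le_abs_self L).trans (by linarith)) ?_ dist_nonneg (by positivity)
            exact hk.le.trans (min_le_right _ _)
        _ = ε / 4 := by field_simp
    have h1 := ((hN m hm).2 x hxa _ hka).trans hLe
    have h2 := ((hN l hl).2 x hxa _ hka).trans hLe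
    have h3 := (hN m hm).1 k hkT
    have h4 := (hN l hl).1 k hkT
    have t1 := dist_triangle4 (F (s m) x) (F (s m) (TopologicalSpace.denseSeq X k)) (y k) (F (s l) x)
    have t2 := dist_triangle_right (y k) (F (s l) x) (F (s l) (TopologicalSpace.denseSeq X k))
    rw [dist_comm (F (s l) _) (y k)] at h4
    linarith
  have hpt : ∀ x, ∃ z, x ∈ U → Tendsto (fun j => F (s j) x) atTop (𝓝 z) := by
    intro x
    by_cases hx : x ∈ U
    · obtain ⟨t, ht, hc⟩ := hcau x hx
      obtain ⟨z, -, hz⟩ := cauchySeq_tendsto_of_isComplete hS.isComplete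
        (fun j => hF (s j) x) (hc.cauchy_map (mem_of_mem_nhds ht))
      exact ⟨z, fun _ => hz⟩
    · exact ⟨F 0 x, fun h => absurd h hx⟩
  choose G hG using hpt
  refine ⟨s, hs, G, fun u hu x hx => ?_⟩
  obtain ⟨t, ht, hc⟩ := hcau x hx
  have := (hc.mono (Set.inter_subset_left (t := U))).tendstoUniformlyOn_of_tendsto
    (fun z hz => hG z hz.2)
  exact ⟨t ∩ U, inter_mem (mem_nhdsWithin_of_mem_nhds ht) self_mem_nhdsWithin, this u hu⟩

end Ascoli

/-! ### Hurwitz's theorem on a disc. -/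

section Hurwitz

/-- **Hurwitz's theorem**: a locally uniform limit of non-vanishing holomorphic functions on a disc
which vanishes at the centre vanishes identically. -/
theorem eq_zero_of_tendstoLocallyUniformlyOn_of_ne_zero {ψ : ℕ → ℂ → ℂ} {φ : ℂ → ℂ} {ρ : ℝ}
    (hd : ∀ᶠ j in atTop, DifferentiableOn ℂ (ψ j) (Metric.ball 0 ρ))
    (hne : ∀ᶠ j in atTop, ∀ ζ ∈ Metric.ball 0 ρ, ψ j ζ ≠ 0)
    (hlim : TendstoLocallyUniformlyOn ψ φ atTop (Metric.ball 0 ρ)) (h0 : φ 0 = 0) {ζ : ℂ}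
    (hζ : ζ ∈ Metric.ball 0 ρ) : φ ζ = 0 := by
  have hρ : 0 < ρ := Metric.pos_of_mem_ball hζ
  have hφ : DifferentiableOn ℂ φ (Metric.ball 0 ρ) := hlim.differentiableOn hd Metric.isOpen_ball
  refine (hφ.analyticOnNhd Metric.isOpen_ball).eqOn_zero_of_preconnected_of_frequently_eq_zero
    (convex_ball 0 ρ).isPreconnected (Metric.mem_ball_self hρ) ?_ hζ
  -- Without a zero on the circle, `|ψ j|` is at least half the minimum of `|φ|` there, and the
  -- maximum principle for `1 / ψ j` keeps `ψ j 0` away from `φ 0 = 0`. Zeros on all small circles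
  -- accumulate at `0`, and the identity theorem applies.
  have hzero : ∀ r, 0 < r → r < ρ → ∃ ξ ∈ Metric.sphere (0 : ℂ) r, φ ξ = 0 := by
    intro r hr hrρ
    by_contra! hcon
    have hsub : Metric.closedBall (0 : ℂ) r ⊆ Metric.ball 0 ρ := Metric.closedBall_subset_ball hrρ
    have hsub' := Metric.sphere_subset_closedBall.trans hsub
    obtain ⟨ξ₀, hξ₀, hmin⟩ := (isCompact_sphere (0 : ℂ) r).exists_isMinOn
      (NormedSpace.sphere_nonempty.2 hr.le) (hφ.continuousOn.mono hsub').norm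
    have hc : 0 < ‖φ ξ₀‖ := norm_pos_iff.2 (hcon ξ₀ hξ₀)
    have hunif := (tendstoLocallyUniformlyOn_iff_forall_isCompact Metric.isOpen_ball).1 hlim
      _ hsub (isCompact_closedBall 0 r)
    rw [Metric.tendstoUniformlyOn_iff] at hunif
    obtain ⟨j, hj, hjd, hjne⟩ := ((hunif (‖φ ξ₀‖ / 2) (by positivity)).and (hd.and hne)).exists
    have hdc : DiffContOnCl ℂ (fun ξ => (ψ j ξ)⁻¹) (Metric.ball 0 r) :=
      DifferentiableOn.diffContOnCl_ball ((hjd.inv hjne).mono hsub) subset_rfl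
    have hbd : ∀ ξ ∈ frontier (Metric.ball (0 : ℂ) r), ‖(ψ j ξ)⁻¹‖ ≤ (‖φ ξ₀‖ / 2)⁻¹ := by
      intro ξ hξ
      rw [frontier_ball _ hr.ne'] at hξ
      rw [norm_inv]
      apply inv_anti₀ (by positivity)
      have h1 := hj ξ (Metric.sphere_subset_closedBall hξ)
      rw [dist_eq_norm] at h1
      have h2 : ‖φ ξ₀‖ ≤ ‖φ ξ‖ := hmin hξ
      have h3 := norm_sub_norm_le (φ ξ) (ψ j ξ)
      linarith
    have hle := Complex.norm_le_of_forall_mem_frontier_norm_le Metric.isBounded_ball hdc hbd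
      (subset_closure (Metric.mem_ball_self hr))
    rw [norm_inv] at hle
    have h4 := (inv_le_inv₀ (norm_pos_iff.2 (hjne 0 (Metric.mem_ball_self hρ)))
      (by positivity)).1 hle
    have h5 := hj 0 (Metric.mem_closedBall_self hr.le)
    rw [h0, dist_zero_left] at h5
    linarith
  rw [frequently_nhdsWithin_iff, Metric.nhds_basis_ball.frequently_iff]
  intro i hi
  obtain ⟨ξ, hξ, hφξ⟩ := hzero (min i ρ / 2) (by positivity) (by
    linarith [min_le_right i ρ, lt_min hi hρ])
  rw [mem_sphere_zero_iff_norm] at hξ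
  have hpos : 0 < min i ρ := lt_min hi hρ
  refine ⟨ξ, ?_, hφξ, ?_⟩
  · rw [mem_ball_zero_iff, hξ]; linarith [min_le_left i ρ]
  · rw [Set.mem_compl_singleton_iff, ← norm_pos_iff, hξ]; positivity

end Hurwitz

/-! ### Marty's theorem through an embedding of the Riemann sphere. -/

section Marty

/-- An embedding of `ℂ` into a bounded subset of `ℂ × ℂ` whose closure is homeomorphic to the
Riemann sphere, the point at infinity corresponding to `(0, 0)`. -/
noncomputable def sphereEmbedding (w : ℂ) : ℂ × ℂ :=
  (w / (1 + w * (starRingEnd ℂ) w), 1 / (1 + w * (starRingEnd ℂ) w))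

theorem norm_one_add_mul_conj (w : ℂ) : ‖1 + w * (starRingEnd ℂ) w‖ = 1 + ‖w‖ ^ 2 := by
  rw [← one_add_norm_sq_eq_mul_conj, Complex.norm_real, Real.norm_of_nonneg (by positivity)]

theorem sphereEmbedding_mem_closedBall (w : ℂ) :
    sphereEmbedding w ∈ Metric.closedBall (0 : ℂ × ℂ) 1 := by
  rw [mem_closedBall_zero_iff, Prod.norm_def, sphereEmbedding, norm_div, norm_div,
    norm_one_add_mul_conj]
  apply max_le
  · rw [div_le_one (by positivity)]; nlinarith [sq_nonneg (‖w‖ - 1)]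
  · rw [div_le_one (by positivity), norm_one]; nlinarith [sq_nonneg ‖w‖]

theorem sphereEmbedding_fst_div_snd (w : ℂ) : (sphereEmbedding w).1 / (sphereEmbedding w).2 = w := by
  have := one_add_mul_conj_ne_zero w
  simp only [sphereEmbedding]
  field_simp

theorem conj_sphereEmbedding_fst (w : ℂ) :
    (starRingEnd ℂ) (sphereEmbedding w).1 = (starRingEnd ℂ) w / (1 + w * (starRingEnd ℂ) w) := by
  simp only [sphereEmbedding, map_div₀, map_add, map_mul, map_one, Complex.conj_conj]
  rw [mul_comm w]

/-- The chart at infinity, continuous where the second coordinate is not `1`. At `w = 0` both sides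
are `0` by the convention for division by zero. -/
theorem conj_sphereEmbedding_fst_div (w : ℂ) :
    (starRingEnd ℂ) (sphereEmbedding w).1 / (1 - (sphereEmbedding w).2) = w⁻¹ := by
  rcases eq_or_ne w 0 with rfl | hw
  · simp [sphereEmbedding]
  have := one_add_mul_conj_ne_zero w
  have hw' : (starRingEnd ℂ) w ≠ 0 := (map_ne_zero _).2 hw
  rw [conj_sphereEmbedding_fst]
  simp only [sphereEmbedding]
  rw [one_sub_div this, add_sub_cancel_left, div_div_div_cancel_right₀ this,
    div_mul_cancel_right₀ hw']

/-- The equation of the sphere is closed, hence inherited by limits; there it links the vanishing of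
the two coordinates. -/
theorem sphereEmbedding_relation (w : ℂ) :
    (sphereEmbedding w).1 * (starRingEnd ℂ) (sphereEmbedding w).1 =
      (sphereEmbedding w).2 * (1 - (sphereEmbedding w).2) := by
  have := one_add_mul_conj_ne_zero w
  rw [conj_sphereEmbedding_fst]
  simp only [sphereEmbedding]
  field_simp
  ring

theorem hasDerivAt_sphereEmbedding {p : ℝ → ℂ} {p' : ℂ} {t : ℝ} (hp : HasDerivAt p p' t) :
    HasDerivAt (fun t => sphereEmbedding (p t))
      ((p' - p t ^ 2 * (starRingEnd ℂ) p') / (1 + p t * (starRingEnd ℂ) (p t)) ^ 2,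
        -(p' * (starRingEnd ℂ) (p t) + p t * (starRingEnd ℂ) p') /
          (1 + p t * (starRingEnd ℂ) (p t)) ^ 2) t := by
  have hden := hasDerivAt_one_add_mul_conj hp
  have hne := one_add_mul_conj_ne_zero (p t)
  have h1 := hp.div hden hne
  have h2 := (hasDerivAt_const t (1 : ℂ)).div hden hne
  refine HasDerivAt.prodMk (h1.congr_deriv ?_) (h2.congr_deriv ?_)
  · congr 1; ring
  · congr 1; ring

theorem norm_deriv_sphereEmbedding_le (p p' : ℂ) :
    ‖((p' - p ^ 2 * (starRingEnd ℂ) p') / (1 + p * (starRingEnd ℂ) p) ^ 2,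
        -(p' * (starRingEnd ℂ) p + p * (starRingEnd ℂ) p') / (1 + p * (starRingEnd ℂ) p) ^ 2)‖ ≤
      ‖p'‖ / (1 + ‖p‖ ^ 2) := by
  rw [Prod.norm_def]
  dsimp only
  rw [norm_div, norm_div, norm_pow, norm_one_add_mul_conj, norm_neg]
  have e : ‖p'‖ / (1 + ‖p‖ ^ 2) = ‖p'‖ * (1 + ‖p‖ ^ 2) / (1 + ‖p‖ ^ 2) ^ 2 := by field_simp
  rw [e]
  apply max_le
  · gcongr
    refine (norm_sub_le _ _).trans (le_of_eq ?_)
    rw [norm_mul, norm_pow, RCLike.norm_conj]; ring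
  · gcongr
    refine (norm_add_le _ _).trans ?_
    rw [norm_mul, norm_mul, RCLike.norm_conj, RCLike.norm_conj]
    nlinarith [norm_nonneg p', mul_nonneg (norm_nonneg p') (sq_nonneg (‖p‖ - 1))]

variable {E : Type*} [NormedAddCommGroup E] [NormedSpace ℂ E]

/-- The embedding has speed at most the spherical one, so a bound on the spherical derivative
integrates along segments to a Lipschitz bound. -/
theorem dist_sphereEmbedding_comp_le {f : E → ℂ} {V : Set E} {C : ℝ} (hV : IsOpen V)
    (hconv : ∀ x ∈ V, ∀ y ∈ V, ∀ t ∈ Set.Icc (0 : ℝ) 1, x + (t : ℂ) • (y - x) ∈ V)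
    (hd : DifferentiableOn ℂ f V)
    (hC : ∀ x ∈ V, ‖fderiv ℂ f x‖ ≤ C * (1 + ‖f x‖ ^ 2)) {x y : E} (hx : x ∈ V) (hy : y ∈ V) :
    dist (sphereEmbedding (f x)) (sphereEmbedding (f y)) ≤ C * dist x y := by
  have hder : ∀ t ∈ Set.Icc (0 : ℝ) 1, HasDerivAt (fun t : ℝ => f (x + (t : ℂ) • (y - x)))
      (fderiv ℂ f (x + (t : ℂ) • (y - x)) (y - x)) t := by
    intro t ht
    exact (hasDerivAt_comp_line (hd.differentiableAt
      (hV.mem_nhds (hconv x hx y hy t ht)))).comp_ofReal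
  have h := norm_image_sub_le_of_norm_deriv_le_segment_01'
    (C := C * ‖y - x‖) (fun t ht => (hasDerivAt_sphereEmbedding (hder t ht)).hasDerivWithinAt)
    (fun t ht => by
      refine (norm_deriv_sphereEmbedding_le _ _).trans ?_
      rw [div_le_iff₀ (by positivity)]
      refine (ContinuousLinearMap.le_opNorm _ _).trans ?_
      calc _ ≤ C * (1 + ‖f (x + (t : ℂ) • (y - x))‖ ^ 2) * ‖y - x‖ := by
            gcongr
            exact hC _ (hconv x hx y hy t (Set.Ico_subset_Icc_self ht))
        _ = _ := by ring)
  rw [dist_comm, dist_comm x, dist_eq_norm, dist_eq_norm]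
  simpa using h

theorem add_smul_sub_mem_ball {a x y : E} {δ t : ℝ} (hx : x ∈ Metric.ball a δ)
    (hy : y ∈ Metric.ball a δ) (ht : t ∈ Set.Icc (0 : ℝ) 1) :
    x + (t : ℂ) • (y - x) ∈ Metric.ball a δ := by
  rw [Complex.coe_smul]
  exact (convex_ball a δ).add_smul_sub_mem hx hy ht

/-- If the limit of `sphereEmbedding ∘ f j` takes the value `∞` at a point, it is constant
near that point. -/
theorem exists_ball_snd_eq_zero_of_snd_eq_zero {f : ℕ → E → ℂ} {G : E → ℂ × ℂ} {a : E} {δ : ℝ}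
    (hδ : 0 < δ) (hd : ∀ᶠ j in atTop, DifferentiableOn ℂ (f j) (Metric.ball a δ))
    (hlim : TendstoLocallyUniformlyOn (fun j x => sphereEmbedding (f j x)) G atTop
      (Metric.ball a δ)) (hG : ContinuousOn G (Metric.ball a δ)) (ha : (G a).2 = 0) :
    ∃ δ' > 0, ∀ x ∈ Metric.ball a δ', (G x).2 = 0 := by
  -- Two margins of `1 / 4` keep the second coordinate of `sphereEmbedding (f j y)` away from `1`,
  -- its value at `0`; hence `f j` has no zeros nearby and `1 / f j` is holomorphic.
  have hGa : ContinuousAt G a := hG.continuousAt (Metric.ball_mem_nhds a hδ)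
  have hnear : ∀ᶠ x in 𝓝 a, ‖(G x).2‖ < 1 / 4 := by
    have : Tendsto (fun x => ‖(G x).2‖) (𝓝 a) (𝓝 ‖(G a).2‖) := (continuous_snd.norm.tendsto _).comp hGa
    rw [ha, norm_zero] at this
    exact this.eventually_lt_const (by norm_num)
  have hloc : ∃ t ∈ 𝓝 a, ∀ᶠ j in atTop, ∀ y ∈ t, dist (G y) (sphereEmbedding (f j y)) < 1 / 4 := by
    have := Metric.tendstoLocallyUniformlyOn_iff.1 hlim (1 / 4) (by norm_num) a
      (Metric.mem_ball_self hδ)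
    rwa [Metric.isOpen_ball.nhdsWithin_eq (Metric.mem_ball_self hδ)] at this
  obtain ⟨t, ht, htj⟩ := hloc
  obtain ⟨δ', hδ', hsub⟩ := Metric.nhds_basis_ball.mem_iff.1
    (inter_mem (inter_mem hnear ht) (Metric.ball_mem_nhds a hδ))
  refine ⟨δ', hδ', fun x hx => ?_⟩
  have hsubδ : Metric.ball a δ' ⊆ Metric.ball a δ := fun y hy => (hsub hy).2
  have hrel : ∀ y ∈ Metric.ball a δ', (G y).1 * (starRingEnd ℂ) (G y).1 =
      (G y).2 * (1 - (G y).2) := by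
    intro y hy
    have hy' : Tendsto (fun j => sphereEmbedding (f j y)) atTop (𝓝 (G y)) :=
      hlim.tendsto_at (hsubδ hy)
    have h1 := (continuous_fst.tendsto _).comp hy'
    have h2 := (continuous_snd.tendsto _).comp hy'
    have h3 := h1.mul ((Complex.continuous_conj.tendsto _).comp h1)
    have h4 := h2.mul (h2.const_sub 1)
    refine tendsto_nhds_unique h3 (h4.congr fun j => ?_)
    exact (sphereEmbedding_relation (f j y)).symm
  have hone : ∀ y ∈ Metric.ball a δ', 1 - (G y).2 ≠ 0 := by
    intro y hy h
    have h1 : ‖(G y).2‖ < 1 / 4 := (hsub hy).1.1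
    rw [← sub_eq_zero.1 h, norm_one] at h1
    norm_num at h1
  have hlim' := hlim.mono hsubδ
  have hG' := hG.mono hsubδ
  have hinv : TendstoLocallyUniformlyOn (fun j y => (f j y)⁻¹)
      (fun y => (starRingEnd ℂ) (G y).1 / (1 - (G y).2)) atTop (Metric.ball a δ') := by
    have h1 : TendstoLocallyUniformlyOn (fun j y => (starRingEnd ℂ) (sphereEmbedding (f j y)).1)
        (fun y => (starRingEnd ℂ) (G y).1) atTop (Metric.ball a δ') :=
      UniformContinuous.comp_tendstoLocallyUniformlyOn
        (g := fun p : ℂ × ℂ => (starRingEnd ℂ) p.1)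
        (Complex.isometry_conj.uniformContinuous.comp uniformContinuous_fst) hlim'
    have h2 : TendstoLocallyUniformlyOn (fun j y => 1 - (sphereEmbedding (f j y)).2)
        (fun y => 1 - (G y).2) atTop (Metric.ball a δ') :=
      UniformContinuous.comp_tendstoLocallyUniformlyOn
        (g := fun p : ℂ × ℂ => 1 - p.2)
        (uniformContinuous_const.sub uniformContinuous_snd) hlim'
    have h3 := h1.div₀ h2 (Complex.continuous_conj.comp_continuousOn
      (continuous_fst.comp_continuousOn hG'))
      (continuousOn_const.sub (continuous_snd.comp_continuousOn hG')) hone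
    refine h3.congr fun j y _ => ?_
    exact conj_sphereEmbedding_fst_div (f j y)
  have hne : ∀ᶠ j in atTop, ∀ y ∈ Metric.ball a δ', f j y ≠ 0 := by
    filter_upwards [htj] with j hj y hy h0
    have h1 : ‖(G y).2‖ < 1 / 4 := (hsub hy).1.1
    have h2 := hj y (hsub hy).1.2
    rw [h0] at h2
    have h3 : dist (G y).2 1 < 1 / 4 := by
      refine lt_of_le_of_lt ?_ h2
      have : dist (G y).2 (sphereEmbedding 0).2 ≤ dist (G y) (sphereEmbedding 0) := le_max_right _ _
      simpa [sphereEmbedding] using this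
    rw [dist_comm, dist_eq_norm] at h3
    have h4 := norm_sub_norm_le (1 : ℂ) (G y).2
    rw [norm_one] at h4
    linarith
  rcases eq_or_ne x a with rfl | hxa
  · exact ha
  set v := x - a with hv
  have hv0 : 0 < ‖v‖ := norm_pos_iff.2 (sub_ne_zero.2 hxa)
  set ρ : ℝ := δ' / ‖v‖ with hρ
  have hline : ∀ ζ ∈ Metric.ball (0 : ℂ) ρ, a + ζ • v ∈ Metric.ball a δ' := by
    intro ζ hζ
    rw [mem_ball_iff_norm, add_sub_cancel_left, norm_smul]
    rw [mem_ball_zero_iff, hρ] at hζ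
    exact (lt_div_iff₀ hv0).1 hζ
  have h1ρ : (1 : ℂ) ∈ Metric.ball (0 : ℂ) ρ := by
    rw [mem_ball_zero_iff, norm_one, hρ, lt_div_iff₀ hv0, one_mul]
    rwa [mem_ball_iff_norm] at hx
  -- Hurwitz's theorem for `1 / f j` on the complex line through `a` and `x`, with `x` at `ζ = 1`.
  have hz := eq_zero_of_tendstoLocallyUniformlyOn_of_ne_zero
    (ψ := fun j ζ => (f j (a + ζ • v))⁻¹)
    (φ := fun ζ => (starRingEnd ℂ) (G (a + ζ • v)).1 / (1 - (G (a + ζ • v)).2)) (ρ := ρ) (by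
      filter_upwards [hd, hne] with j hj hjne
      refine DifferentiableOn.inv ?_ fun ζ hζ => hjne _ (hline ζ hζ)
      exact (hj.mono hsubδ).comp (by fun_prop) hline)
    (by
      filter_upwards [hne] with j hjne ζ hζ
      exact inv_ne_zero (hjne _ (hline ζ hζ)))
    (hinv.comp (fun ζ : ℂ => a + ζ • v) hline (by fun_prop))
    (by
      have := hrel a (Metric.mem_ball_self hδ')
      rw [ha, zero_mul] at this
      have hA : (G a).1 = 0 := by
        rcases mul_eq_zero.1 this with h | h
        · exact h
        · exact (map_eq_zero _).1 h
      simp [hA])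
    h1ρ
  have hxv : a + (1 : ℂ) • v = x := by rw [one_smul, hv]; abel
  simp only [hxv] at hz
  rcases div_eq_zero_iff.1 hz with h | h
  · have := hrel x hx
    rw [h, mul_zero, eq_comm] at this
    exact (mul_eq_zero.1 this).resolve_right (hone x hx)
  · exact absurd h (hone x hx)

variable [ProperSpace E]

/-- **Marty's theorem** (sufficiency): a sequence of holomorphic functions with locally bounded
spherical derivatives has a subsequence which converges locally uniformly to a finite limit or
to `∞`. -/
theorem exists_subseq_of_norm_fderiv_le {f : ℕ → E → ℂ} {U : Set E} (hU : IsOpen U)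
    (hUc : IsPreconnected U)
    (hf : ∀ a ∈ U, ∃ δ > 0, ∃ C : ℝ, ∀ᶠ j in atTop, DifferentiableOn ℂ (f j) (Metric.ball a δ) ∧
      ∀ x ∈ Metric.ball a δ, ‖fderiv ℂ (f j) x‖ ≤ C * (1 + ‖f j x‖ ^ 2)) :
    ∃ s : ℕ → ℕ, StrictMono s ∧
      ((∃ g : E → ℂ, TendstoLocallyUniformlyOn (fun j => f (s j)) g atTop U) ∨
        ∀ K ⊆ U, IsCompact K → ∀ M : ℝ, ∀ᶠ j in atTop, ∀ z ∈ K, M < ‖f (s j) z‖) := by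
  obtain ⟨s, hs, G, hG⟩ := exists_subseq_tendstoLocallyUniformlyOn_of_locally_lipschitz
    (isCompact_closedBall (0 : ℂ × ℂ) 1) (F := fun j x => sphereEmbedding (f j x))
    (fun j x => sphereEmbedding_mem_closedBall _) (U := U) (fun a ha => by
      obtain ⟨δ, hδ, C, hj⟩ := hf a ha
      refine ⟨δ, hδ, C, hj.mono fun j hj x hx y hy => ?_⟩
      exact dist_sphereEmbedding_comp_le Metric.isOpen_ball
        (fun x hx y hy t ht => add_smul_sub_mem_ball hx hy ht) hj.1 hj.2 hx hy)
  refine ⟨s, hs, ?_⟩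
  have hGc : ContinuousOn G U := by
    intro a ha
    obtain ⟨δ, hδ, C, hj⟩ := hf a ha
    obtain ⟨δ', hδ', hsub⟩ := Metric.nhds_basis_ball.mem_iff.1
      (inter_mem (Metric.ball_mem_nhds a hδ) (hU.mem_nhds ha))
    have hc : ContinuousOn G (Metric.ball a δ') := by
      refine (hG.mono fun x hx => (hsub hx).2).continuousOn (Eventually.frequently ?_)
      filter_upwards [hs.tendsto_atTop.eventually hj] with j hj
      have hlip : LipschitzOnWith C.toNNReal (fun x => sphereEmbedding (f (s j) x))
          (Metric.ball a δ') := LipschitzOnWith.of_dist_le_mul fun x hx y hy => by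
        refine (dist_sphereEmbedding_comp_le Metric.isOpen_ball
          (fun x hx y hy t ht => add_smul_sub_mem_ball hx hy ht) hj.1 hj.2
          (hsub hx).1 (hsub hy).1).trans ?_
        gcongr
        exact Real.le_coe_toNNReal C
      exact hlip.continuousOn
    exact (hc.continuousAt (Metric.ball_mem_nhds a hδ')).continuousWithinAt
  -- The points with limit `∞` form an open set by Hurwitz, the others by continuity; connectedness
  -- leaves only one kind.
  have hopen0 : IsOpen {x ∈ U | (G x).2 = 0} := by
    rw [Metric.isOpen_iff]
    rintro a ⟨ha, ha0⟩
    obtain ⟨δ, hδ, C, hj⟩ := hf a ha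
    obtain ⟨δ₁, hδ₁, hsub⟩ := Metric.nhds_basis_ball.mem_iff.1
      (inter_mem (Metric.ball_mem_nhds a hδ) (hU.mem_nhds ha))
    obtain ⟨δ₂, hδ₂, h⟩ := exists_ball_snd_eq_zero_of_snd_eq_zero (f := fun j => f (s j)) hδ₁
      ((hs.tendsto_atTop.eventually hj).mono fun j hj => hj.1.mono fun x hx => (hsub hx).1)
      (hG.mono fun x hx => (hsub hx).2) (hGc.mono fun x hx => (hsub hx).2) ha0
    refine ⟨min δ₁ δ₂, lt_min hδ₁ hδ₂, fun x hx => ⟨?_, ?_⟩⟩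
    · exact (hsub (Metric.ball_subset_ball (min_le_left _ _) hx)).2
    · exact h x (Metric.ball_subset_ball (min_le_right _ _) hx)
  have hopen1 : IsOpen {x ∈ U | (G x).2 ≠ 0} :=
    (continuous_snd.comp_continuousOn hGc).isOpen_inter_preimage hU isOpen_compl_singleton
  rcases hUc.subset_or_subset hopen1 hopen0
    (Set.disjoint_left.2 fun x h1 h0 => h1.2 h0.2)
    (fun x hx => (em ((G x).2 = 0)).symm.imp (⟨hx, ·⟩) (⟨hx, ·⟩)) with h1 | h0
  · left
    refine ⟨fun x => (G x).1 / (G x).2, ?_⟩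
    have t1 := uniformContinuous_fst.comp_tendstoLocallyUniformlyOn hG
    have t2 := uniformContinuous_snd.comp_tendstoLocallyUniformlyOn hG
    refine (t1.div₀ t2 (continuous_fst.comp_continuousOn hGc)
      (continuous_snd.comp_continuousOn hGc) fun x hx => (h1 hx).2).congr fun j x _ => ?_
    exact sphereEmbedding_fst_div_snd _
  · right
    intro K hK hKc M
    have hu := (tendstoLocallyUniformlyOn_iff_forall_isCompact hU).1 hG K hK hKc
    rw [Metric.tendstoUniformlyOn_iff] at hu
    filter_upwards [hu (1 / (1 + M ^ 2)) (by positivity)] with j hj x hx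
    have h2 : dist (G x).2 (sphereEmbedding (f (s j) x)).2 < 1 / (1 + M ^ 2) :=
      (le_max_right _ _).trans_lt (hj x hx)
    rw [(h0 (hK hx)).2, dist_zero_left, sphereEmbedding, norm_div, norm_one,
      norm_one_add_mul_conj, one_div_lt_one_div (by positivity) (by positivity)] at h2
    exact lt_of_pow_lt_pow_left₀ 2 (norm_nonneg _) (by linarith)

end Marty

/-! ### Spherical derivatives under rescaling and the choice of centre and scale. -/

section Rescaling

variable {E : Type*} [NormedAddCommGroup E] [NormedSpace ℂ E]

/-- The spherical derivative at `0` of the rescaled function `w ↦ r ^ α * f (z + r w)`. -/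
noncomputable def rescaledDeriv (α : ℝ) (f : E → ℂ) (z : E) (r : ℝ) : ℝ :=
  r ^ (1 + α) * ‖fderiv ℂ f z‖ / (1 + (r ^ α) ^ 2 * ‖f z‖ ^ 2)

theorem norm_fderiv_rescale_div {α r : ℝ} {f : E → ℂ} {z w : E} (hr : 0 < r)
    (hf : DifferentiableAt ℂ f (z + (r : ℂ) • w)) :
    ‖fderiv ℂ (fun w => ((r ^ α : ℝ) : ℂ) * f (z + (r : ℂ) • w)) w‖ /
        (1 + ‖((r ^ α : ℝ) : ℂ) * f (z + (r : ℂ) • w)‖ ^ 2) =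
      rescaledDeriv α f (z + (r : ℂ) • w) r := by
  have h1 : HasFDerivAt (fun w : E => z + (r : ℂ) • w) ((r : ℂ) • ContinuousLinearMap.id ℂ E) w :=
    ((hasFDerivAt_id w).const_smul (r : ℂ)).const_add z
  have h2 : HasFDerivAt (fun w => ((r ^ α : ℝ) : ℂ) * f (z + (r : ℂ) • w))
      (((r ^ α : ℝ) : ℂ) • (r : ℂ) • fderiv ℂ f (z + (r : ℂ) • w)) w := by
    refine ((hf.hasFDerivAt.comp w h1).const_mul ((r ^ α : ℝ) : ℂ)).congr_fderiv ?_
    ext v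
    simp
  have hrα : 0 < r ^ α := Real.rpow_pos_of_pos hr α
  rw [h2.fderiv, rescaledDeriv, norm_smul, norm_smul, norm_mul, Complex.norm_real,
    Complex.norm_real, Real.norm_of_nonneg hrα.le, Real.norm_of_nonneg hr.le, mul_pow,
    Real.rpow_add hr, Real.rpow_one]
  ring

theorem rescaledDeriv_nonneg (α : ℝ) (f : E → ℂ) (z : E) {r : ℝ} (hr : 0 ≤ r) :
    0 ≤ rescaledDeriv α f z r := by
  have := Real.rpow_nonneg hr (1 + α)
  rw [rescaledDeriv]; positivity

theorem rescaledDeriv_le (α : ℝ) (f : E → ℂ) (z : E) {r : ℝ} (hr : 0 ≤ r) :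
    rescaledDeriv α f z r ≤ r ^ (1 + α) * ‖fderiv ℂ f z‖ := by
  have := Real.rpow_nonneg hr (1 + α)
  refine div_le_self (by positivity) ?_
  rw [le_add_iff_nonneg_right]; positivity

theorem rescaledDeriv_zero {α : ℝ} (hα : -1 < α) (f : E → ℂ) (z : E) :
    rescaledDeriv α f z 0 = 0 := by
  rw [rescaledDeriv, Real.zero_rpow (by linarith), zero_mul, zero_div]

/-- For `α ≥ 0` the denominator only decreases; for `α < 0` it grows at most by `r^(2α)`, which
leaves the exponent `1 - α`. Bounds on rescaled derivatives thus become the bounds Marty's theorem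
needs. -/
theorem rpow_mul_le_rescaledDeriv (α : ℝ) (f : E → ℂ) (z : E) {r : ℝ} (hr : 0 < r) (hr1 : r ≤ 1) :
    r ^ (1 + |α|) * (‖fderiv ℂ f z‖ / (1 + ‖f z‖ ^ 2)) ≤ rescaledDeriv α f z r := by
  have hq : 0 < r ^ α := Real.rpow_pos_of_pos hr α
  have hp : 0 < r ^ (1 + α) := Real.rpow_pos_of_pos hr _
  rw [rescaledDeriv]
  rcases le_or_gt 0 α with hα | hα
  · rw [abs_of_nonneg hα, ← mul_div_assoc]
    have h1 : (r ^ α) ^ 2 ≤ 1 := pow_le_one₀ hq.le (Real.rpow_le_one hr.le hr1 hα)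
    gcongr
    exact mul_le_of_le_one_left (by positivity) h1
  · have h1 : 1 ≤ (r ^ α) ^ 2 := one_le_pow₀ (Real.one_le_rpow_of_pos_of_le_one_of_nonpos hr hr1 hα.le)
    have h2 : r ^ (1 + |α|) * (r ^ α) ^ 2 = r ^ (1 + α) := by
      rw [abs_of_neg hα, ← Real.rpow_natCast (r ^ α), ← Real.rpow_mul hr.le, ← Real.rpow_add hr]
      congr 1; push_cast; ring
    rw [← mul_div_assoc, div_le_div_iff₀ (by positivity) (by positivity), ← h2]
    have h3 : 0 ≤ r ^ (1 + |α|) * ‖fderiv ℂ f z‖ := by positivity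
    calc r ^ (1 + |α|) * ‖fderiv ℂ f z‖ * (1 + (r ^ α) ^ 2 * ‖f z‖ ^ 2)
        ≤ r ^ (1 + |α|) * ‖fderiv ℂ f z‖ * ((r ^ α) ^ 2 * (1 + ‖f z‖ ^ 2)) := by
          gcongr; linarith
      _ = _ := by ring

/-- A bound for the change of `rescaledDeriv` when the radius is multiplied by `lam`. -/
noncomputable def rescalingFactor (α lam : ℝ) : ℝ := lam ^ (1 + α) * max 1 ((lam ^ α) ^ 2)⁻¹

theorem rescalingFactor_one (α : ℝ) : rescalingFactor α 1 = 1 := by simp [rescalingFactor]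

theorem rescalingFactor_nonneg {α lam : ℝ} (h : 0 ≤ lam) : 0 ≤ rescalingFactor α lam :=
  mul_nonneg (Real.rpow_nonneg h _) (zero_le_one.trans (le_max_left _ _))

theorem continuousAt_rescalingFactor {α lam : ℝ} (h : 0 < lam) :
    ContinuousAt (rescalingFactor α) lam := by
  refine (Real.continuousAt_rpow_const _ _ (Or.inl h.ne')).mul
    (continuousAt_const.max (((Real.continuousAt_rpow_const _ _ (Or.inl h.ne')).pow 2).inv₀ ?_))
  exact pow_ne_zero _ (Real.rpow_pos_of_pos h α).ne'

/-- The numerator scales by `lam^(1+α)`, and the denominator shrinks at most by the factor `min(1,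
lam^(2α))`. What matters later is that the resulting factor is continuous with value `1` at `lam =
1`. -/
theorem rescaledDeriv_mul_le (α : ℝ) (f : E → ℂ) (z : E) {r lam : ℝ} (hr : 0 < r) (hl : 0 < lam) :
    rescaledDeriv α f z (lam * r) ≤ rescalingFactor α lam * rescaledDeriv α f z r := by
  have hp : 0 < r ^ (1 + α) := Real.rpow_pos_of_pos hr _
  have hp' : 0 < lam ^ (1 + α) := Real.rpow_pos_of_pos hl _
  have hl2 : 0 < (lam ^ α) ^ 2 := pow_pos (Real.rpow_pos_of_pos hl α) 2
  rw [rescaledDeriv, rescaledDeriv, rescalingFactor, Real.mul_rpow hl.le hr.le,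
    Real.mul_rpow hl.le hr.le, mul_pow]
  set L := (lam ^ α) ^ 2
  set Y := (r ^ α) ^ 2 * ‖f z‖ ^ 2 with hY
  have hY0 : 0 ≤ Y := by positivity
  have key : 1 + Y ≤ max 1 L⁻¹ * (1 + L * Y) := by
    have h1 : 1 ≤ max 1 L⁻¹ := le_max_left _ _
    have h2 : 1 ≤ max 1 L⁻¹ * L := by
      calc 1 = L⁻¹ * L := (inv_mul_cancel₀ hl2.ne').symm
        _ ≤ _ := by gcongr; exact le_max_right _ _
    nlinarith [mul_le_mul_of_nonneg_right h2 hY0]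
  rw [mul_assoc L, ← hY, ← mul_div_assoc, div_le_div_iff₀ (by positivity) (by positivity)]
  have h3 : 0 ≤ lam ^ (1 + α) * r ^ (1 + α) * ‖fderiv ℂ f z‖ := by positivity
  calc lam ^ (1 + α) * r ^ (1 + α) * ‖fderiv ℂ f z‖ * (1 + Y)
      ≤ lam ^ (1 + α) * r ^ (1 + α) * ‖fderiv ℂ f z‖ * (max 1 L⁻¹ * (1 + L * Y)) := by gcongr
    _ = _ := by ring

/-- Where the radius vanishes, `r^α` may be discontinuous, but the quotient is squeezed between `0`
and `r^(1+α) ‖f'‖`; this is where `α > -1` enters. -/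
theorem continuousOn_rescaledDeriv {α : ℝ} (hα : -1 < α) {f : E → ℂ} {K : Set E} {T : Set ℝ}
    {ρ : E → ℝ → ℝ} (hf : ContinuousOn f K) (hf' : ContinuousOn (fderiv ℂ f) K)
    (hρ : ContinuousOn (fun p : E × ℝ => ρ p.1 p.2) (K ×ˢ T))
    (hρ0 : ∀ z ∈ K, ∀ t ∈ T, 0 ≤ ρ z t) :
    ContinuousOn (fun p : E × ℝ => rescaledDeriv α f p.1 (ρ p.1 p.2)) (K ×ˢ T) := by
  have hfst : Set.MapsTo Prod.fst (K ×ˢ T) K := fun p hp => hp.1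
  have h1 : ContinuousOn (fun p : E × ℝ => ‖fderiv ℂ f p.1‖) (K ×ˢ T) :=
    (hf'.comp continuousOn_fst hfst).norm
  have h2 : ContinuousOn (fun p : E × ℝ => ‖f p.1‖) (K ×ˢ T) :=
    (hf.comp continuousOn_fst hfst).norm
  have h3 : ContinuousOn (fun p : E × ℝ => ρ p.1 p.2 ^ (1 + α)) (K ×ˢ T) :=
    hρ.rpow_const fun p _ => Or.inr (by linarith)
  intro p hp
  rcases (hρ0 p.1 hp.1 p.2 hp.2).eq_or_lt with h0 | h0
  · rw [ContinuousWithinAt, ← h0, rescaledDeriv_zero hα]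
    have hlim : Tendsto (fun p : E × ℝ => ρ p.1 p.2 ^ (1 + α) * ‖fderiv ℂ f p.1‖)
        (𝓝[K ×ˢ T] p) (𝓝 0) := by
      have := (h3 p hp).mul (h1 p hp)
      rw [ContinuousWithinAt, Pi.mul_apply, ← h0, Real.zero_rpow (by linarith), zero_mul] at this
      exact this
    refine tendsto_of_tendsto_of_tendsto_of_le_of_le' tendsto_const_nhds hlim ?_ ?_
    · filter_upwards [self_mem_nhdsWithin] with q hq
      exact rescaledDeriv_nonneg _ _ _ (hρ0 _ hq.1 _ hq.2)
    · filter_upwards [self_mem_nhdsWithin] with q hq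
      exact rescaledDeriv_le _ _ _ (hρ0 _ hq.1 _ hq.2)
  · unfold rescaledDeriv
    have h4 : ContinuousWithinAt (fun p : E × ℝ => ρ p.1 p.2 ^ α) (K ×ˢ T) p :=
      (hρ p hp).rpow_const (Or.inl h0.ne')
    refine ((h3 p hp).mul (h1 p hp)).div
      (continuousWithinAt_const.add ((h4.pow 2).mul ((h2 p hp).pow 2))) ?_
    positivity

/-- The choice of centre and scale in the Zalcman–Pang rescaling lemma. -/
theorem exists_rescaledDeriv_eq_one [ProperSpace E] {α : ℝ} (hα : -1 < α) {f : E → ℂ} {z₀ ζ : E} {ρ τ : ℝ}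
    (hf : ContinuousOn f (Metric.closedBall z₀ ρ))
    (hf' : ContinuousOn (fderiv ℂ f) (Metric.closedBall z₀ ρ)) (hτ : 0 ≤ τ)
    (hζ : ζ ∈ Metric.closedBall z₀ ρ) (h : 1 ≤ rescaledDeriv α f ζ (τ * (ρ - ‖ζ - z₀‖))) :
    ∃ z ∈ Metric.ball z₀ ρ, ∃ t, 0 < t ∧ t ≤ τ ∧
      rescaledDeriv α f z (t * (ρ - ‖z - z₀‖)) = 1 ∧
      ∀ y ∈ Metric.closedBall z₀ ρ, rescaledDeriv α f y (t * (ρ - ‖y - z₀‖)) ≤ 1 := by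
  set Ψ : E × ℝ → ℝ := fun p => rescaledDeriv α f p.1 (p.2 * (ρ - ‖p.1 - z₀‖)) with hΨ
  have hΨc : ContinuousOn Ψ (Metric.closedBall z₀ ρ ×ˢ Set.Icc 0 τ) := by
    refine continuousOn_rescaledDeriv hα (ρ := fun z t => t * (ρ - ‖z - z₀‖)) hf hf' ?_ ?_
    · fun_prop
    · intro z hz t ht
      rw [mem_closedBall_iff_norm] at hz
      exact mul_nonneg ht.1 (by linarith)
  have hKc : IsCompact (Metric.closedBall z₀ ρ ×ˢ Set.Icc 0 τ) :=
    (isCompact_closedBall z₀ ρ).prod isCompact_Icc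
  have hTc : IsCompact ((Metric.closedBall z₀ ρ ×ˢ Set.Icc 0 τ) ∩ Ψ ⁻¹' Set.Ici 1) :=
    hKc.of_isClosed_subset (hΨc.preimage_isClosed_of_isClosed hKc.isClosed isClosed_Ici)
      Set.inter_subset_left
  -- The least parameter `t` for which `Ψ` reaches `1` anywhere on the ball.
  obtain ⟨⟨z, t⟩, ⟨⟨hz, ht⟩, hzt⟩, hmin⟩ := hTc.exists_isMinOn
    ⟨(ζ, τ), ⟨hζ, ⟨hτ, le_rfl⟩⟩, h⟩ continuousOn_snd
  simp only [Set.mem_preimage, Set.mem_Ici, hΨ] at hzt hz ht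
  have hr0 : t * (ρ - ‖z - z₀‖) ≠ 0 := by
    intro h0
    rw [h0, rescaledDeriv_zero hα] at hzt
    norm_num at hzt
  have ht0 : 0 < t := ht.1.lt_of_ne' (left_ne_zero_of_mul hr0)
  -- Minimality gives `Ψ(y, s) < 1` for `0 < s < t`; let `s` increase to `t`.
  have hle : ∀ y ∈ Metric.closedBall z₀ ρ, rescaledDeriv α f y (t * (ρ - ‖y - z₀‖)) ≤ 1 := by
    intro y hy
    have hc : ContinuousWithinAt (fun s => Ψ (y, s)) (Set.Icc 0 τ) t :=
      (hΨc (y, t) ⟨hy, ht⟩).comp (by fun_prop) fun s hs => ⟨hy, hs⟩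
    have hmem : Set.Ioo 0 t ∈ 𝓝[<] t := Ioo_mem_nhdsLT ht0
    have hsub : Set.Ioo 0 t ⊆ Set.Icc 0 τ := fun s hs => ⟨hs.1.le, hs.2.le.trans ht.2⟩
    have hlim : Tendsto (fun s => Ψ (y, s)) (𝓝[<] t) (𝓝 (Ψ (y, t))) :=
      hc.mono_left (nhdsWithin_le_iff.2 (mem_of_superset hmem hsub))
    refine le_of_tendsto hlim ?_
    filter_upwards [hmem] with s hs
    by_contra! hcon
    have : t ≤ s := hmin (a := (y, s)) ⟨⟨hy, hsub hs⟩, hcon.le⟩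
    exact absurd hs.2 this.not_gt
  refine ⟨z, ?_, t, ht0, ht.2, le_antisymm (hle z hz) hzt, hle⟩
  rw [mem_closedBall_iff_norm] at hz
  rw [mem_ball_iff_norm]
  exact hz.lt_of_ne fun h' => hr0 (by rw [h', sub_self, mul_zero])

/-- Near the centre of the rescaling, the radius function `y ↦ t (ρ - ‖y - z₀‖)` is comparable to
its value at the centre. -/
theorem rescaled_radius_bounds {z₀ z w : E} {ρ t : ℝ} (ht : 0 < t) (hz : z ∈ Metric.ball z₀ ρ) :
    |t * (ρ - ‖z + ((t * (ρ - ‖z - z₀‖) : ℝ) : ℂ) • w - z₀‖) - t * (ρ - ‖z - z₀‖)| ≤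
      t * ‖w‖ * (t * (ρ - ‖z - z₀‖)) := by
  rw [mem_ball_iff_norm] at hz
  have hr : 0 ≤ t * (ρ - ‖z - z₀‖) := mul_nonneg ht.le (by linarith)
  set r := t * (ρ - ‖z - z₀‖) with hrdef
  have h1 : |‖z + (r : ℂ) • w - z₀‖ - ‖z - z₀‖| ≤ r * ‖w‖ := by
    refine (abs_norm_sub_norm_le _ _).trans (le_of_eq ?_)
    rw [show z + (r : ℂ) • w - z₀ - (z - z₀) = (r : ℂ) • w by abel, norm_smul, Complex.norm_real,
      Real.norm_of_nonneg hr]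
  have h2 : t * (ρ - ‖z + (r : ℂ) • w - z₀‖) - r =
      -(t * (‖z + (r : ℂ) • w - z₀‖ - ‖z - z₀‖)) := by rw [hrdef]; ring
  rw [h2, abs_neg, abs_mul, abs_of_pos ht]
  calc t * |‖z + (r : ℂ) • w - z₀‖ - ‖z - z₀‖| ≤ t * (r * ‖w‖) := by gcongr
    _ = _ := by ring

/-- At the shifted point the bound `1` is known for that point's own radius `r'`. Passing to the
common radius `r` costs `rescalingFactor` at `lam = r / r'`. -/
theorem rescaled_mem_ball_and_rescaledDeriv_le {α : ℝ} {f : E → ℂ} {z₀ z w : E} {ρ t : ℝ}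
    (ht : 0 < t) (hz : z ∈ Metric.ball z₀ ρ)
    (hle : ∀ y ∈ Metric.closedBall z₀ ρ, rescaledDeriv α f y (t * (ρ - ‖y - z₀‖)) ≤ 1)
    (hw : t * ‖w‖ < 1) :
    z + ((t * (ρ - ‖z - z₀‖) : ℝ) : ℂ) • w ∈ Metric.ball z₀ ρ ∧
      ∃ lam, (1 + t * ‖w‖)⁻¹ ≤ lam ∧ lam ≤ (1 - t * ‖w‖)⁻¹ ∧
        rescaledDeriv α f (z + ((t * (ρ - ‖z - z₀‖) : ℝ) : ℂ) • w) (t * (ρ - ‖z - z₀‖)) ≤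
          rescalingFactor α lam := by
  have hb := abs_le.1 (rescaled_radius_bounds (w := w) ht hz)
  rw [mem_ball_iff_norm] at hz
  have hr : 0 < t * (ρ - ‖z - z₀‖) := mul_pos ht (by linarith)
  set r := t * (ρ - ‖z - z₀‖) with hrdef
  set y := z + (r : ℂ) • w with hy
  set r' := t * (ρ - ‖y - z₀‖) with hr'
  have hε0 : 0 ≤ t * ‖w‖ := by positivity
  have hlow : (1 - t * ‖w‖) * r ≤ r' := by linarith [hb.1]
  have hupp : r' ≤ (1 + t * ‖w‖) * r := by linarith [hb.2]
  have hr'0 : 0 < r' := (mul_pos (by linarith) hr).trans_le hlow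
  have hyb : y ∈ Metric.ball z₀ ρ := by
    rw [mem_ball_iff_norm]
    linarith [pos_of_mul_pos_right hr'0 ht.le]
  refine ⟨hyb, r / r', ?_, ?_, ?_⟩
  · rw [inv_eq_one_div, div_le_div_iff₀ (by linarith) hr'0]; linarith
  · rw [inv_eq_one_div, div_le_div_iff₀ hr'0 (by linarith)]; linarith
  · have h1 := rescaledDeriv_mul_le α f y hr'0 (div_pos hr hr'0)
    rw [div_mul_cancel₀ _ hr'0.ne'] at h1
    refine h1.trans (mul_le_of_le_one_right (rescalingFactor_nonneg (div_pos hr hr'0).le) ?_)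
    exact hle y (Metric.ball_subset_closedBall hyb)

end Rescaling

/-! ### Zalcman–Pang rescaling and its converse. -/

section Zalcman

variable {n : ℕ}

theorem exists_one_le_rescaledDeriv_of_not_isNormalAt {Ω : Set (EuclideanSpace ℂ (Fin n))}
    {F : Set (EuclideanSpace ℂ (Fin n) → ℂ)} (hF : ∀ f ∈ F, DifferentiableOn ℂ f Ω)
    {z₀ : EuclideanSpace ℂ (Fin n)} (hN : ¬ IsNormalAt F Ω z₀) (α : ℝ) {ρ τ : ℝ} (hρ : 0 < ρ)
    (hρ1 : ρ ≤ 1) (hτ : 0 < τ) (hτ1 : τ ≤ 1) (hsub : Metric.closedBall z₀ ρ ⊆ Ω) :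
    ∃ f ∈ F, ∃ ζ ∈ Metric.closedBall z₀ ρ,
      1 ≤ rescaledDeriv α f ζ (τ * (ρ - ‖ζ - z₀‖)) := by
  by_contra! hcon
  have hball : Metric.ball z₀ (ρ / 2) ⊆ Metric.closedBall z₀ ρ :=
    (Metric.ball_subset_ball (by linarith)).trans Metric.ball_subset_closedBall
  refine hN ⟨Metric.ball z₀ (ρ / 2), hball.trans hsub, Metric.isOpen_ball,
    Metric.mem_ball_self (half_pos hρ), fun f hf => ?_⟩
  -- On the half ball the radius is at least `τ ρ / 2`, so `c⁻¹` bounds the spherical derivatives.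
  set c : ℝ := (τ * ρ / 2) ^ (1 + |α|) with hc
  have hc0 : 0 < c := Real.rpow_pos_of_pos (by positivity) _
  have hbound : ∀ j, ∀ x ∈ Metric.ball z₀ (ρ / 2),
      ‖fderiv ℂ (f j) x‖ ≤ c⁻¹ * (1 + ‖f j x‖ ^ 2) := by
    intro j x hx
    have h1 := hcon (f j) (hf j) x (hball hx)
    rw [mem_ball_iff_norm] at hx
    have hr0 : τ * ρ / 2 ≤ τ * (ρ - ‖x - z₀‖) := by
      rw [mul_div_assoc]; gcongr; linarith
    have hr1 : τ * (ρ - ‖x - z₀‖) ≤ 1 :=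
      mul_le_one₀ hτ1 (by linarith) (by linarith [norm_nonneg (x - z₀)])
    have h2 := rpow_mul_le_rescaledDeriv α (f j) x (lt_of_lt_of_le (by positivity) hr0) hr1
    have h3 : c ≤ (τ * (ρ - ‖x - z₀‖)) ^ (1 + |α|) :=
      Real.rpow_le_rpow (by positivity) hr0 (by positivity)
    have h4 : c * (‖fderiv ℂ (f j) x‖ / (1 + ‖f j x‖ ^ 2)) ≤ 1 := by
      refine le_trans ?_ (h2.trans h1.le)
      gcongr
    rw [← mul_div_assoc, div_le_one (by positivity)] at h4
    rw [inv_mul_eq_div, le_div_iff₀ hc0]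
    linarith
  obtain ⟨s, hs, h⟩ := exists_subseq_of_norm_fderiv_le (f := f) Metric.isOpen_ball
    (convex_ball z₀ (ρ / 2)).isPreconnected (fun a ha => by
      obtain ⟨δ, hδ, hδs⟩ := Metric.isOpen_iff.1 Metric.isOpen_ball a ha
      exact ⟨δ, hδ, c⁻¹, Eventually.of_forall fun j =>
        ⟨(hF _ (hf j)).mono ((hδs.trans hball).trans hsub), fun x hx => hbound j x (hδs hx)⟩⟩)
  refine ⟨s, hs, h.imp_left ?_⟩
  rintro ⟨g, hg⟩
  exact ⟨g, (tendstoLocallyUniformlyOn_iff_forall_isCompact Metric.isOpen_ball).1 hg⟩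

/-- Functions which are large near the origin and holomorphic there have small spherical
derivative at the origin. -/
theorem norm_fderiv_div_lt_one_of_lt_norm {E : Type*} [NormedAddCommGroup E] [NormedSpace ℂ E]
    {f : E → ℂ} (hd : DifferentiableOn ℂ f (Metric.ball 0 1))
    (hM : ∀ x ∈ Metric.ball (0 : E) 1, 3 < ‖f x‖) :
    ‖fderiv ℂ f 0‖ / (1 + ‖f 0‖ ^ 2) < 1 := by
  have hne : ∀ x ∈ Metric.ball (0 : E) 1, f x ≠ 0 := fun x hx =>
    norm_pos_iff.1 (by linarith [hM x hx])
  have h0 : (0 : E) ∈ Metric.ball (0 : E) 1 := Metric.mem_ball_self one_pos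
  -- The Cauchy estimate for `1 / f` yields `‖f'(0)‖ ≤ (2 / 3) ‖f 0‖²`.
  have hest := norm_fderiv_le_of_norm_le_ball one_pos (hd.inv hne) (C := 1 / 3) fun x hx => by
    rw [Pi.inv_apply, norm_inv, inv_eq_one_div]
    exact one_div_le_one_div_of_le (by norm_num) (hM x hx).le
  have hder : HasFDerivAt f⁻¹ (-(f 0 ^ 2)⁻¹ • fderiv ℂ f 0) 0 :=
    (hasDerivAt_inv (hne 0 h0)).comp_hasFDerivAt 0
      (hd.differentiableAt (Metric.isOpen_ball.mem_nhds h0)).hasFDerivAt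
  rw [hder.fderiv, norm_smul, norm_neg, norm_inv, norm_pow, inv_mul_eq_div] at hest
  have hpos : 0 < ‖f 0‖ ^ 2 := pow_pos (norm_pos_iff.2 (hne 0 h0)) 2
  rw [div_le_iff₀ hpos] at hest
  rw [div_lt_one (by positivity)]
  linarith

theorem exists_rescaled_limit_of_not_isNormalAt {Ω : Set (EuclideanSpace ℂ (Fin n))}
    (hΩ : IsOpen Ω) {F : Set (EuclideanSpace ℂ (Fin n) → ℂ)}
    (hF : ∀ f ∈ F, DifferentiableOn ℂ f Ω) {z₀ : EuclideanSpace ℂ (Fin n)} (hz₀ : z₀ ∈ Ω)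
    (hN : ¬ IsNormalAt F Ω z₀) {α : ℝ} (hα : -1 < α) :
    ∃ (f : ℕ → EuclideanSpace ℂ (Fin n) → ℂ) (z : ℕ → EuclideanSpace ℂ (Fin n)) (r : ℕ → ℝ)
      (g : EuclideanSpace ℂ (Fin n) → ℂ),
      (∀ j, f j ∈ F) ∧
      (∀ j, z j ∈ Ω) ∧ Tendsto z atTop (𝓝 z₀) ∧
      (∀ j, 0 < r j) ∧ Tendsto r atTop (𝓝 0) ∧
      TendstoLocallyUniformly
        (fun j (w : EuclideanSpace ℂ (Fin n)) => ((r j ^ α : ℝ) : ℂ) * f j (z j + (r j : ℂ) • w))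
        g atTop ∧
      Differentiable ℂ g ∧ (¬ ∃ c, ∀ w, g w = c) ∧
      (∀ w, sphericalDeriv g w ≤ 1) ∧ sphericalDeriv g 0 = 1 := by
  obtain ⟨ρ₀, hρ₀, hρΩ⟩ := Metric.nhds_basis_closedBall.mem_iff.1 (hΩ.mem_nhds hz₀)
  set τ : ℕ → ℝ := fun m => 1 / ((m : ℝ) + 1) with hτ
  have hτ0 : ∀ m, 0 < τ m := fun m => Nat.one_div_pos_of_nat
  have hτ1 : ∀ m, τ m ≤ 1 := fun m => by
    rw [hτ]; exact (div_le_one (by positivity)).2 (by linarith [Nat.cast_nonneg (α := ℝ) m])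
  have hτlim : Tendsto τ atTop (𝓝 0) := tendsto_one_div_add_atTop_nhds_zero_nat
  -- Shrinking `ρ` forces the centres to `z₀`, and the cap `ρ₀` keeps the balls in `Ω`; shrinking
  -- `τ` forces `t → 0`, which drives the ratio of radii to `1`.
  set ρ : ℕ → ℝ := fun m => min (τ m) ρ₀ with hρ
  have hρ0 : ∀ m, 0 < ρ m := fun m => lt_min (hτ0 m) hρ₀
  have hρ1 : ∀ m, ρ m ≤ 1 := fun m => (min_le_left _ _).trans (hτ1 m)
  have hρlim : Tendsto ρ atTop (𝓝 0) :=
    squeeze_zero (fun m => (hρ0 m).le) (fun m => min_le_left _ _) hτlim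
  have hρs : ∀ m, Metric.closedBall z₀ (ρ m) ⊆ Ω := fun m =>
    (Metric.closedBall_subset_closedBall (min_le_right _ _)).trans hρΩ
  have hchoice : ∀ m, ∃ f ∈ F, ∃ z ∈ Metric.ball z₀ (ρ m), ∃ t, 0 < t ∧ t ≤ τ m ∧
      rescaledDeriv α f z (t * (ρ m - ‖z - z₀‖)) = 1 ∧
      ∀ y ∈ Metric.closedBall z₀ (ρ m), rescaledDeriv α f y (t * (ρ m - ‖y - z₀‖)) ≤ 1 := by
    intro m
    obtain ⟨f, hf, ζ, hζ, h⟩ := exists_one_le_rescaledDeriv_of_not_isNormalAt hF hN α (hρ0 m)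
      (hρ1 m) (hτ0 m) (hτ1 m) (hρs m)
    exact ⟨f, hf, exists_rescaledDeriv_eq_one hα ((hF f hf).continuousOn.mono (hρs m))
      ((continuousOn_fderiv_of_differentiableOn hΩ (hF f hf)).mono (hρs m)) (hτ0 m).le hζ h⟩
  choose f hfF z hz t ht0 htτ heq hle using hchoice
  have htlim : Tendsto t atTop (𝓝 0) := squeeze_zero (fun m => (ht0 m).le) htτ hτlim
  set r : ℕ → ℝ := fun m => t m * (ρ m - ‖z m - z₀‖) with hr
  have hzn : ∀ m, ‖z m - z₀‖ < ρ m := fun m => mem_ball_iff_norm.1 (hz m)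
  have hr0 : ∀ m, 0 < r m := fun m => mul_pos (ht0 m) (by linarith [hzn m])
  have hrlim : Tendsto r atTop (𝓝 0) := by
    refine squeeze_zero (fun m => (hr0 m).le) (fun m => ?_) htlim
    exact mul_le_of_le_one_right (ht0 m).le (by linarith [hρ1 m, norm_nonneg (z m - z₀)])
  have hzlim : Tendsto z atTop (𝓝 z₀) := by
    rw [tendsto_iff_norm_sub_tendsto_zero]
    exact squeeze_zero (fun m => norm_nonneg _) (fun m => (hzn m).le) hρlim
  set G : ℕ → EuclideanSpace ℂ (Fin n) → ℂ :=
    fun m w => ((r m ^ α : ℝ) : ℂ) * f m (z m + (r m : ℂ) • w) with hG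
  have hsmall : ∀ R : ℝ, ∀ᶠ m in atTop, t m * R < 1 / 2 := by
    intro R
    have := htlim.mul_const R
    rw [zero_mul] at this
    exact this.eventually_lt_const (by norm_num)
  have hmem : ∀ m w, t m * ‖w‖ < 1 → z m + (r m : ℂ) • w ∈ Ω := fun m w hw =>
    hρs m (Metric.ball_subset_closedBall
      (rescaled_mem_ball_and_rescaledDeriv_le (ht0 m) (hz m) (hle m) hw).1)
  have hfd : ∀ m w, t m * ‖w‖ < 1 → DifferentiableAt ℂ (f m) (z m + (r m : ℂ) • w) :=
    fun m w hw => (hF _ (hfF m)).differentiableAt (hΩ.mem_nhds (hmem m w hw))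
  have hGd : ∀ m w, t m * ‖w‖ < 1 → DifferentiableAt ℂ (G m) w := fun m w hw =>
    ((hfd m w hw).comp w (by fun_prop)).const_mul _
  have hGsharp : ∀ m w, t m * ‖w‖ < 1 → ∃ lam, (1 + t m * ‖w‖)⁻¹ ≤ lam ∧
      lam ≤ (1 - t m * ‖w‖)⁻¹ ∧
      ‖fderiv ℂ (G m) w‖ / (1 + ‖G m w‖ ^ 2) ≤ rescalingFactor α lam := by
    intro m w hw
    obtain ⟨-, lam, h1, h2, h3⟩ :=
      rescaled_mem_ball_and_rescaledDeriv_le (ht0 m) (hz m) (hle m) hw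
    refine ⟨lam, h1, h2, ?_⟩
    rw [hG, norm_fderiv_rescale_div (hr0 m) (hfd m w hw)]
    exact h3
  have hG0 : ∀ m, ‖fderiv ℂ (G m) 0‖ / (1 + ‖G m 0‖ ^ 2) = 1 := by
    intro m
    rw [hG, norm_fderiv_rescale_div (hr0 m) (hfd m 0 (by simp)), smul_zero, add_zero]
    exact heq m
  -- Once `t ‖x‖ < 1 / 2`, the ratio of radii lies in `[1/2, 2]`, so a single `C` serves every unit
  -- ball.
  obtain ⟨C, hC⟩ := (isCompact_Icc (a := (1 / 2 : ℝ)) (b := 2)).exists_bound_of_continuousOn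
    (f := rescalingFactor α) fun lam hlam =>
      (continuousAt_rescalingFactor (by linarith [hlam.1])).continuousWithinAt
  have hlocal : ∀ a : EuclideanSpace ℂ (Fin n), ∀ᶠ m in atTop,
      DifferentiableOn ℂ (G m) (Metric.ball a 1) ∧
      ∀ x ∈ Metric.ball a 1, ‖fderiv ℂ (G m) x‖ ≤ C * (1 + ‖G m x‖ ^ 2) := by
    intro a
    filter_upwards [hsmall (‖a‖ + 1)] with m hm
    have hx : ∀ x ∈ Metric.ball a 1, t m * ‖x‖ < 1 / 2 := by
      intro x hx
      rw [mem_ball_iff_norm] at hx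
      refine lt_of_le_of_lt (mul_le_mul_of_nonneg_left ?_ (ht0 m).le) hm
      linarith [norm_sub_norm_le x a]
    refine ⟨fun x h => (hGd m x (by linarith [hx x h])).differentiableWithinAt, fun x h => ?_⟩
    have hx1 := hx x h
    have hx0 : 0 ≤ t m * ‖x‖ := mul_nonneg (ht0 m).le (norm_nonneg x)
    obtain ⟨lam, h1, h2, h3⟩ := hGsharp m x (by linarith)
    have hlam : lam ∈ Set.Icc (1 / 2 : ℝ) 2 := by
      constructor
      · refine le_trans ?_ h1
        rw [inv_eq_one_div]
        exact one_div_le_one_div_of_le (by linarith) (by linarith)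
      · refine h2.trans ?_
        rw [inv_le_comm₀ (by linarith) (by norm_num)]
        linarith
    have h4 := h3.trans ((le_abs_self _).trans (hC lam hlam))
    rwa [div_le_iff₀ (by positivity)] at h4
  obtain ⟨s, hs, hcases⟩ := exists_subseq_of_norm_fderiv_le (f := G) isOpen_univ
    isPreconnected_univ fun a _ => ⟨1, one_pos, C, hlocal a⟩
  have hst := hs.tendsto_atTop
  rcases hcases with ⟨g, hg⟩ | hinf
  swap
  -- Divergence to `∞` would make the spherical derivative at `0` less than `1`, yet it equals `1`
  -- for every rescaled function.
  · exfalso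
    have h1 := hinf (Metric.closedBall 0 1) (Set.subset_univ _) (isCompact_closedBall 0 1) 3
    obtain ⟨j, hj1, hj2⟩ := (h1.and (hst.eventually (hlocal 0))).exists
    have := norm_fderiv_div_lt_one_of_lt_norm hj2.1 fun x hx =>
      hj1 x (Metric.ball_subset_closedBall hx)
    rw [hG0] at this
    exact lt_irrefl _ this
  rw [tendstoLocallyUniformlyOn_univ] at hg
  have hlimit : ∀ a, DifferentiableAt ℂ g a ∧
      Tendsto (fun j => fderiv ℂ (G (s j)) a) atTop (𝓝 (fderiv ℂ g a)) := fun a =>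
    differentiableAt_and_tendsto_fderiv_of_tendstoUniformlyOn_ball one_pos
      ((hst.eventually (hlocal a)).mono fun _ h => h.1)
      ((tendstoLocallyUniformly_iff_forall_isCompact.1 hg _ (isCompact_closedBall a 1)).mono
        Metric.ball_subset_closedBall)
  have hgd : Differentiable ℂ g := fun a => (hlimit a).1
  have hsharp : ∀ a, Tendsto (fun j => ‖fderiv ℂ (G (s j)) a‖ / (1 + ‖G (s j) a‖ ^ 2)) atTop
      (𝓝 (sphericalDeriv g a)) := by
    intro a
    rw [sphericalDeriv_eq hgd]
    have hga : Tendsto (fun j => G (s j) a) atTop (𝓝 (g a)) :=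
      (tendstoLocallyUniformlyOn_univ.2 hg).tendsto_at (Set.mem_univ a)
    exact (hlimit a).2.norm.div ((hga.norm.pow 2).const_add 1) (by positivity)
  have hg0 : sphericalDeriv g 0 = 1 := by
    refine tendsto_nhds_unique (hsharp 0) ?_
    simp only [hG0]
    exact tendsto_const_nhds
  refine ⟨fun j => f (s j), fun j => z (s j), fun j => r (s j), g, fun j => hfF _,
    fun j => hρs _ (Metric.ball_subset_closedBall (hz _)), hzlim.comp hst, fun j => hr0 _,
    hrlim.comp hst, hg, hgd, ?_, fun a => ?_, hg0⟩
  · rintro ⟨c, hc⟩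
    rw [sphericalDeriv_eq hgd, show g = fun _ => c from funext hc] at hg0
    simp at hg0
  -- At a fixed point the ratios of radii tend to `1`, so the constant in the bound improves to `1`
  -- in the limit. The default `0` is used for only finitely many `j`.
  · have hex : ∀ j, ∃ lam, t (s j) * ‖a‖ < 1 → (1 + t (s j) * ‖a‖)⁻¹ ≤ lam ∧
        lam ≤ (1 - t (s j) * ‖a‖)⁻¹ ∧
        ‖fderiv ℂ (G (s j)) a‖ / (1 + ‖G (s j) a‖ ^ 2) ≤ rescalingFactor α lam := by
      intro j
      by_cases h : t (s j) * ‖a‖ < 1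
      · obtain ⟨lam, hl⟩ := hGsharp (s j) a h
        exact ⟨lam, fun _ => hl⟩
      · exact ⟨0, fun h' => absurd h' h⟩
    choose lam hlam using hex
    have hta : Tendsto (fun j => t (s j) * ‖a‖) atTop (𝓝 0) := by
      simpa using (htlim.comp hst).mul_const ‖a‖
    have hev : ∀ᶠ j in atTop, t (s j) * ‖a‖ < 1 := hta.eventually_lt_const one_pos
    have hl1 : Tendsto (fun j => (1 + t (s j) * ‖a‖)⁻¹) atTop (𝓝 1) := by
      simpa using (hta.const_add 1).inv₀ (by norm_num)
    have hl2 : Tendsto (fun j => (1 - t (s j) * ‖a‖)⁻¹) atTop (𝓝 1) := by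
      simpa using (hta.const_sub 1).inv₀ (by norm_num)
    have hlamlim : Tendsto lam atTop (𝓝 1) :=
      tendsto_of_tendsto_of_tendsto_of_le_of_le' hl1 hl2
        (hev.mono fun j hj => (hlam j hj).1) (hev.mono fun j hj => (hlam j hj).2.1)
    have hK : Tendsto (fun j => rescalingFactor α (lam j)) atTop (𝓝 1) := by
      have := (continuousAt_rescalingFactor (α := α) one_pos).tendsto.comp hlamlim
      rwa [rescalingFactor_one] at this
    exact le_of_tendsto_of_tendsto (hsharp a) hK (hev.mono fun j hj => (hlam j hj).2.2)

/-- For each `w` the sample points tend to `z₀`. A finite limit `h` near `z₀` is continuous, so `g w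
= h z₀`; an infinite one contradicts convergence at `w = 0`. -/
theorem eq_const_of_isNormalAt_of_tendsto {Ω : Set (EuclideanSpace ℂ (Fin n))}
    {F : Set (EuclideanSpace ℂ (Fin n) → ℂ)} (hF : ∀ f ∈ F, ContinuousOn f Ω)
    {z₀ : EuclideanSpace ℂ (Fin n)} (hN : IsNormalAt F Ω z₀)
    {f : ℕ → EuclideanSpace ℂ (Fin n) → ℂ} (hf : ∀ j, f j ∈ F)
    {z : ℕ → EuclideanSpace ℂ (Fin n)} (hz : Tendsto z atTop (𝓝 z₀)) {r : ℕ → ℝ}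
    (hr : Tendsto r atTop (𝓝 0)) {g : EuclideanSpace ℂ (Fin n) → ℂ}
    (hg : ∀ w, Tendsto (fun j => f j (z j + (r j : ℂ) • w)) atTop (𝓝 (g w))) :
    ∃ c, ∀ w, g w = c := by
  obtain ⟨U, hUΩ, hU, hzU, hnorm⟩ := hN
  obtain ⟨s, hs, hcases⟩ := hnorm f hf
  obtain ⟨R, hR, hRU⟩ := Metric.nhds_basis_closedBall.mem_iff.1 (hU.mem_nhds hzU)
  have hst := hs.tendsto_atTop
  have hx : ∀ w, Tendsto (fun j => z (s j) + (r (s j) : ℂ) • w) atTop (𝓝 z₀) := by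
    intro w
    have h1 : Tendsto (fun j => ((r (s j) : ℝ) : ℂ) • w) atTop (𝓝 (((0 : ℝ) : ℂ) • w)) :=
      ((Complex.continuous_ofReal.tendsto 0).comp (hr.comp hst)).smul_const w
    simpa using (hz.comp hst).add h1
  have hmem : ∀ w, ∀ᶠ j in atTop, z (s j) + (r (s j) : ℂ) • w ∈ Metric.closedBall z₀ R :=
    fun w => (hx w).eventually (Metric.closedBall_mem_nhds z₀ hR)
  have hgs : ∀ w, Tendsto (fun j => f (s j) (z (s j) + (r (s j) : ℂ) • w)) atTop (𝓝 (g w)) :=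
    fun w => (hg w).comp hst
  rcases hcases with ⟨h, hh⟩ | hinf
  · have hu := hh _ hRU (isCompact_closedBall z₀ R)
    have hc : ContinuousOn h (Metric.closedBall z₀ R) :=
      hu.continuousOn (Frequently.of_forall fun j => (hF _ (hf _)).mono (hRU.trans hUΩ))
    refine ⟨h z₀, fun w => tendsto_nhds_unique (hgs w) ?_⟩
    exact tendsto_comp_of_locally_uniform_limit_within
      (hc z₀ (Metric.mem_closedBall_self hR.le))
      (tendsto_nhdsWithin_iff.2 ⟨hx w, hmem w⟩)
      fun u hu' => ⟨_, self_mem_nhdsWithin, hu u hu'⟩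
  · exfalso
    have h1 := hinf _ hRU (isCompact_closedBall z₀ R) (‖g 0‖ + 1)
    have h2 := (hgs 0).norm.eventually_lt_const (lt_add_one ‖g 0‖)
    obtain ⟨j, hj1, hj2, hj3⟩ := (h1.and (h2.and (hmem 0))).exists
    exact lt_asymm hj2 (hj1 _ hj3)

end Zalcman

theorem theorem1p2 (n : ℕ) (Ω : Set (EuclideanSpace ℂ (Fin n))) (hΩ : IsOpen Ω)
    (hΩc : IsConnected Ω) (F : Set (EuclideanSpace ℂ (Fin n) → ℂ))
    (hF : ∀ f ∈ F, DifferentiableOn ℂ f Ω)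
    (z₀ : EuclideanSpace ℂ (Fin n)) (hz₀ : z₀ ∈ Ω) :
    ¬ IsNormalAt F Ω z₀ ↔
      ∀ α : ℝ, -1 < α →
        ∃ (f : ℕ → EuclideanSpace ℂ (Fin n) → ℂ) (z : ℕ → EuclideanSpace ℂ (Fin n)) (r : ℕ → ℝ)
          (g : EuclideanSpace ℂ (Fin n) → ℂ),
          (∀ j, f j ∈ F) ∧
          (∀ j, z j ∈ Ω) ∧ Tendsto z atTop (𝓝 z₀) ∧
          (∀ j, 0 < r j) ∧ Tendsto r atTop (𝓝 0) ∧
          TendstoLocallyUniformly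
            (fun j (w : EuclideanSpace ℂ (Fin n)) => ((r j ^ α : ℝ) : ℂ) * f j (z j + (r j : ℂ) • w))
            g atTop ∧
          Differentiable ℂ g ∧ (¬ ∃ c, ∀ w, g w = c) ∧
          (∀ w, sphericalDeriv g w ≤ 1) ∧ sphericalDeriv g 0 = 1 := by
  refine ⟨fun hN α hα => exists_rescaled_limit_of_not_isNormalAt hΩ hF hz₀ hN hα, fun h hN => ?_⟩
  -- With `α = 0` the prefactor is `1`, and the values of `f j` themselves converge.
  obtain ⟨f, z, r, g, hf, -, hz, -, hr, hg, -, hne, -⟩ := h 0 (by norm_num)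
  refine hne (eq_const_of_isNormalAt_of_tendsto (fun f hf => (hF f hf).continuousOn) hN hf hz hr
    fun w => ?_)
  simpa using (tendstoLocallyUniformlyOn_univ.2 hg).tendsto_at (Set.mem_univ w)
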